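/- Let $\lambda_1\ge\lambda_2\ge\lambda_3\ge 0$ be integers, put $\lambda_{ij}=\lambda_i-\lambda_j$, and let $g>0$ be real. Write $(a)_n=a(a+1)\cdots(a+n-1)$ and $${}_4F_3\!\left(\begin{array}{c}a_1,a_2,a_3,a_4\\ b_1,b_2,b_3\end{array}\Big|\,1\right)=\sum_{k\ge0}\frac{(a_1)_k(a_2)_k(a_3)_k(a_4)_k}{(b_1)_k(b_2)_k(b_3)_k\,k!}.$$ Let $P_\lambda^{(1/g)}(x_1,x_2,x_3)$ be the Jack polynomial: the unique symmetric polynomial of the form $m_\lambda+\sum_{\mu<\lambda}u_{\mu}m_\mu$ (monomial symmetric polynomials, dominance order) that is an eigenfunction, with eigenvalue $\sum_{i=1}^3\lambda_i(\lambda_i+g(4-2i))$, of $$H_g=\sum_{i=1}^3\Big(x_i\frac{\partial}{\partial x_i}\Big)^2+g\sum_{i<j}\frac{x_i+x_j}{x_i-x_j}\Big(x_i\frac{\partial}{\partial x_i}-x_j\frac{\partial}{\partial x_j}\Big);$$ such a polynomial exists and is unique. For $m,n\ge0$ put $$A_{mn}(g)=\frac{(g)_{\lambda_{23}}(2g)_{\lambda_{13}}}{(g)_{\lambda_{12}}(1-g)_{\lambda_{23}}}\frac{\lambda_{12}!}{\lambda_{13}!}\,\frac{1}{m!\,n!}\,\frac{(-\lambda_{13})_{m+n}(g-\lambda_{23})_{m+n}(1-g)_m}{(1-2g-\lambda_{13})_m(1-g-\lambda_{23})_m(2g)_n}\;{}_4F_3\!\left(\begin{array}{c}-\lambda_{23},\,g,\,-g-\lambda_{13},\,1-2g-m-n\\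 1-g-\lambda_{23},\,1-2g-\lambda_{13},\,g-m\end{array}\Big|\,1\right),$$ $$B_{mn}(g)=\frac{(g)_{\lambda_{13}+1}}{(g)_{\lambda_{23}+1}}\frac{\lambda_{23}!}{\lambda_{13}!}\,\frac{1}{m!\,n!}\,\frac{(-\lambda_{13})_{m+n}(1-2g-\lambda_{23})_m(2g)_{m+n}}{(1-2g-\lambda_{13})_m(1-g-\lambda_{23})_m(2g)_n}\;{}_4F_3\!\left(\begin{array}{c}-\lambda_{12},\,g,\,2g+\lambda_{23},\,1-g+\lambda_{23}-m-n\\ 1+g+\lambda_{23},\,1-g-\lambda_{12},\,2g+\lambda_{23}-m\end{array}\Big|\,1\right),$$ where the ${}_4F_3$ series terminate at $k=\lambda_{23}$ and at $k=\lambda_{12}$, respectively. Then, for all $x_1,x_2,x_3\in\mathbb C$ with $x_3\ne0$, $$P_\lambda^{(1/g)}(x_1,x_2,x_3)=(x_1x_2)^{\lambda_3}x_3^{\lambda_1+\lambda_2-\lambda_3}\sum_{0\le m+n\le\lambda_{13}}C_{mn}\left[\frac{x_1x_2}{x_3^2}\right]^m\left[\Big(1-\frac{x_1}{x_3}\Big)\Big(1-\frac{x_2}{x_3}\Big)\right]^n$$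 holds 1. with $C_{mn}=A_{mn}(g)$ whenever $g\notin\{1,\dots,\lambda_{13}\}$ (exactly the condition that no denominator in the first formula vanishes); 2. with $C_{mn}=B_{mn}(g)$ whenever $g\notin\{1,\dots,\lambda_{12}\}$ and $2g\notin\{1,\dots,\lambda_{12}\}$ (exactly the condition that no denominator in the second formula vanishes); 3. for every $g>0$, with $C_{mn}=\lim_{t\to g,\,t\ne g}A_{mn}(t)=\lim_{t\to g,\,t\neq g}B_{mn}(t)$; both limits exist and are equal for all $m,n\ge 0$ with $m+n\le\lambda_{13}$. -/

import Mathlib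

open Filter Topology

noncomputable section

namespace Jack

/-- The Pochhammer symbol `(a)_n = a (a + 1) ⋯ (a + n - 1)`. -/
def poch (a : ℝ) (n : ℕ) : ℝ := (ascPochhammer ℝ n).eval a

/-- The hypergeometric series `₄F₃(a₁, a₂, a₃, a₄; b₁, b₂, b₃ | z)`. -/
def hyp4F3 (a₁ a₂ a₃ a₄ b₁ b₂ b₃ z : ℝ) : ℝ :=
  ∑' k : ℕ, poch a₁ k * poch a₂ k * poch a₃ k * poch a₄ k /
    (poch b₁ k * poch b₂ k * poch b₃ k) * (z ^ k / (k.factorial : ℝ))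

/-- The Euler operator `x_i ∂/∂x_i` on polynomials. -/
def euler {n : ℕ} (i : Fin n) (P : MvPolynomial (Fin n) ℝ) : MvPolynomial (Fin n) ℝ :=
  MvPolynomial.X i * MvPolynomial.pderiv i P

/-- The value at a point `x` with pairwise distinct coordinates of `H_g P`, where
`H_g = ∑ i, (x_i ∂_i)² + g ∑_{i < j} (x_i + x_j) / (x_i - x_j) (x_i ∂_i - x_j ∂_j)`
is the gauge-transformed Calogero–Sutherland Hamiltonian. -/
def hamiltonianAt {n : ℕ} (g : ℝ) (P : MvPolynomial (Fin n) ℝ) (x : Fin n → ℝ) : ℝ :=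
  (∑ i, MvPolynomial.eval x (euler i (euler i P))) +
    g * ∑ i, ∑ j ∈ Finset.Ioi i, (x i + x j) / (x i - x j) *
      (MvPolynomial.eval x (euler i P) - MvPolynomial.eval x (euler j P))

/-- The eigenvalue `E_g = ∑_{i=1}^n l_i (l_i + g (n + 1 - 2 i))`; the index `i : Fin n` of the
code is the index `i + 1` of the formula. -/
def eigenvalue {n : ℕ} (g : ℝ) (l : Fin n → ℕ) : ℝ :=
  ∑ i : Fin n, (l i : ℝ) * ((l i : ℝ) + g * ((n : ℝ) + 1 - 2 * ((i : ℕ) + 1 : ℝ)))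

/-- Dominance order `m ≤ l`: equal weights, and each partial sum of `m` is at most that of `l`. -/
def Dominated {n : ℕ} (m l : Fin n → ℕ) : Prop :=
  ∑ i, m i = ∑ i, l i ∧ ∀ k : Fin n, ∑ i ∈ Finset.Iic k, m i ≤ ∑ i ∈ Finset.Iic k, l i

/-- `P` is the Jack polynomial `P_l^{(1/g)}` in `n` variables of the partition
`l = (l_1 ≥ ⋯ ≥ l_n ≥ 0)`: a symmetric polynomial of the form
`m_l + ∑_{μ < l} u_μ m_μ` (monomial symmetric functions, dominance order) which is an
eigenfunction of `H_g` with eigenvalue `E_g`. -/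
structure IsJack {n : ℕ} (g : ℝ) (l : Fin n → ℕ) (P : MvPolynomial (Fin n) ℝ) : Prop where
  symmetric : P.IsSymmetric
  leading : P.coeff (Finsupp.equivFunOnFinite.symm l) = 1
  triangular : ∀ μ : Fin n → ℕ, Antitone μ →
    P.coeff (Finsupp.equivFunOnFinite.symm μ) ≠ 0 → Dominated μ l
  eigen : ∀ x : Fin n → ℝ, Function.Injective x →
    hamiltonianAt g P x = eigenvalue g l * MvPolynomial.eval x P

/-- The difference `l₁₂` of the first two parts of a partition with three parts
(subtraction does not truncate, as it is used for antitone `l` only). -/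
def l12 (l : Fin 3 → ℕ) : ℕ := l 0 - l 1

/-- The difference `l₂₃`. -/
def l23 (l : Fin 3 → ℕ) : ℕ := l 1 - l 2

/-- The difference `l₁₃`. -/
def l13 (l : Fin 3 → ℕ) : ℕ := l 0 - l 2

/-- The coefficient of the first representation, with its prefactor. -/
def firstCoeff (l : Fin 3 → ℕ) (g : ℝ) (m n : ℕ) : ℝ :=
  (poch g (l23 l) * poch (2 * g) (l13 l)) / (poch g (l12 l) * poch (1 - g) (l23 l)) *
    (((l12 l).factorial : ℝ) / ((l13 l).factorial : ℝ)) *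
    (1 / ((m.factorial : ℝ) * (n.factorial : ℝ))) *
    ((poch (-(l13 l : ℝ)) (m + n) * poch (g - l23 l) (m + n) * poch (1 - g) m) /
      (poch (1 - 2 * g - l13 l) m * poch (1 - g - l23 l) m * poch (2 * g) n)) *
    hyp4F3 (-(l23 l : ℝ)) g (-g - l13 l) (1 - 2 * g - m - n)
      (1 - g - l23 l) (1 - 2 * g - l13 l) (g - m) 1

/-- The coefficient of the second representation, with its prefactor. -/
def secondCoeff (l : Fin 3 → ℕ) (g : ℝ) (m n : ℕ) : ℝ :=
  poch g (l13 l + 1) / poch g (l23 l + 1) *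
    (((l23 l).factorial : ℝ) / ((l13 l).factorial : ℝ)) *
    (1 / ((m.factorial : ℝ) * (n.factorial : ℝ))) *
    hyp4F3 (-(l12 l : ℝ)) g (2 * g + l23 l) (1 - g + l23 l - m - n)
      (1 + g + l23 l) (1 - g - l12 l) (2 * g + l23 l - m) 1 *
    ((poch (-(l13 l : ℝ)) (m + n) * poch (1 - 2 * g - l23 l) m * poch (2 * g) (m + n)) /
      (poch (1 - 2 * g - l13 l) m * poch (1 - g - l23 l) m * poch (2 * g) n))

/-- The sum over `0 ≤ m + n ≤ l₁₃` with coefficients `c m n`, in the basis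
`[x₁x₂/x₃²]^m [(1 - x₁/x₃)(1 - x₂/x₃)]^n`, times `(x₁x₂)^{l₃} x₃^{l₁+l₂-l₃}`. -/
def expansion (l : Fin 3 → ℕ) (c : ℕ → ℕ → ℝ) (x : Fin 3 → ℂ) : ℂ :=
  (x 0 * x 1) ^ l 2 * x 2 ^ (l 0 + l 1 - l 2) *
    ∑ p ∈ Finset.range (l13 l + 1) ×ˢ Finset.range (l13 l + 1) with p.1 + p.2 ≤ l13 l,
      (c p.1 p.2 : ℂ) * (x 0 * x 1 / x 2 ^ 2) ^ p.1 *
        ((1 - x 0 / x 2) * (1 - x 1 / x 2)) ^ p.2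

end Jack

end

/-! The proof compares two descriptions of one polynomial in $u=x_1x_2/x_3^2$ and
$v=(1-x_1/x_3)(1-x_2/x_3)$: one coming from the Jack polynomial, the other from the hypergeometric
formulas.

Jack side. On monomials $e_1^ae_2^be_3^c$ in the elementary symmetric polynomials, $H_g$ is
triangular: besides a diagonal term it produces three monomials, whose leading exponents are lower
by the three positive roots of $A_2$. For $g>0$ the differences of diagonal entries are positive, so
an eigenvector can be solved for recursively (`jackCoeff`, `jackPoly`). This gives existence and
shows that the coefficients are continuous in $g$. Uniqueness compares lexicographically leading
terms: the difference of two Jack polynomials would have a leading exponent strictly dominated by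
$\lambda$ but with the same eigenvalue (`IsJack.unique`). At $x_3=1$ one has $e_1=2+u-v$,
$e_2=1+2u-v$, $e_3=u$, so the Jack polynomial becomes a polynomial `uvPoly` in $u,v$ of total degree
at most $\lambda_{13}$. The eigenvalue equation becomes a linear recurrence for its coefficients
(`recurrence_uvPoly`).

Hypergeometric side. Both arrays satisfy that recurrence when $2g$ is not an integer
(`recurrence_coeffTerm`). The proof is creative telescoping with a single rational certificate: the
two ${}_4F_3$ have the same term ratios, up to starting the summation index at $\delta=0$ or at
$\delta=\lambda_{23}+g$. These are two roots of the factor of the certificate that must vanish at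
the lower end.

Matching. For irrational $g$ the recurrence, the vanishing for $m+n>\lambda_{13}$ and the entry at
$(0,\lambda_{13})$ determine an array (`Recurrence.eq_of_irrational`). That entry is
$(-1)^{\lambda_{13}}$ in all three arrays, by Chu–Vandermonde for the hypergeometric ones. Equality
then passes from irrational $g$ to every $g>0$ where the formula has no vanishing denominator, by
continuity. At the remaining $g$ the coefficients of `uvPoly` are still continuous, hence are the
common limits. -/

namespace Jack

/-! ### Pochhammer symbols and the Chu–Vandermonde sum. -/

section Pochhammer

theorem poch_zero (a : ℝ) : poch a 0 = 1 := by simp [poch]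

theorem poch_succ (a : ℝ) (n : ℕ) : poch a (n + 1) = poch a n * (a + n) := by
  simp [poch, ascPochhammer_succ_eval]

theorem poch_eq_prod (a : ℝ) (n : ℕ) : poch a n = ∏ i ∈ Finset.range n, (a + i) := by
  induction n with
  | zero => simp [poch_zero]
  | succ n ih => rw [poch_succ, ih, Finset.prod_range_succ]

theorem poch_add (a : ℝ) (m n : ℕ) : poch a (m + n) = poch a m * poch (a + m) n := by
  induction n with
  | zero => simp [poch_zero]
  | succ n ih => rw [← add_assoc, poch_succ, ih, poch_succ]; push_cast; ring

theorem poch_succ_left (a : ℝ) (n : ℕ) : poch a (n + 1) = a * poch (a + 1) n := by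
  rw [add_comm, poch_add, poch_succ, poch_zero]; simp

theorem poch_shift (a b : ℝ) (h : b = a + 1) (n : ℕ) : poch a n * (a + n) = a * poch b n := by
  rw [h, ← poch_succ_left, poch_succ]

theorem poch_ne_zero {a : ℝ} {n : ℕ} (h : ∀ i < n, a + i ≠ 0) : poch a n ≠ 0 := by
  rw [poch_eq_prod]
  exact Finset.prod_ne_zero_iff.2 fun i hi => h i (Finset.mem_range.1 hi)

theorem poch_pos {a : ℝ} (ha : 0 < a) (n : ℕ) : 0 < poch a n := by
  rw [poch_eq_prod]
  exact Finset.prod_pos fun i _ => by positivity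

theorem poch_neg_natCast_eq_zero {n k : ℕ} (h : n < k) : poch (-(n : ℝ)) k = 0 := by
  rw [poch_eq_prod]
  exact Finset.prod_eq_zero (Finset.mem_range.2 h) (by simp)

theorem poch_neg (a : ℝ) (n : ℕ) : poch (1 - a - n) n = (-1) ^ n * poch a n := by
  induction n with
  | zero => simp [poch_zero]
  | succ n ih =>
    rw [poch_succ_left, poch_succ, pow_succ]
    have : (1 - a - ((n + 1 : ℕ) : ℝ) + 1) = 1 - a - n := by push_cast; ring
    rw [this, ih]; push_cast; ring

theorem poch_one (n : ℕ) : poch 1 n = n.factorial := by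
  induction n with
  | zero => simp [poch_zero]
  | succ n ih => rw [poch_succ, ih, Nat.factorial_succ]; push_cast; ring

theorem poch_neg_self (n : ℕ) : poch (-(n : ℝ)) n = (-1) ^ n * n.factorial := by
  rw [← poch_one, ← poch_neg]; congr 1; ring

theorem factorial_mul_poch (m n : ℕ) :
    (m.factorial : ℝ) * poch (1 + m) n = (m + n).factorial := by
  rw [← poch_one, ← poch_one, poch_add]

theorem continuous_poch (n : ℕ) : Continuous fun a : ℝ => poch a n :=
  (ascPochhammer ℝ n).continuous

theorem hyp4F3_eq_sum (n : ℕ) (a₂ a₃ a₄ b₁ b₂ b₃ : ℝ) :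
    hyp4F3 (-(n : ℝ)) a₂ a₃ a₄ b₁ b₂ b₃ 1 =
      ∑ k ∈ Finset.range (n + 1), poch (-(n : ℝ)) k * poch a₂ k * poch a₃ k * poch a₄ k /
        (poch b₁ k * poch b₂ k * poch b₃ k * k.factorial) := by
  unfold hyp4F3
  rw [tsum_eq_sum (s := Finset.range (n + 1))]
  · refine Finset.sum_congr rfl fun k _ => ?_
    rw [one_pow, mul_one_div, div_div]
  · intro k hk
    rw [poch_neg_natCast_eq_zero (by simpa using hk)]; simp

/-- The Chu–Vandermonde sum. -/
theorem sum_poch_chu_vandermonde (n : ℕ) : ∀ b c : ℝ, (∀ i < n, c + i ≠ 0) →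
    ∑ k ∈ Finset.range (n + 1), poch (-(n : ℝ)) k * poch b k / (poch c k * k.factorial) =
      poch (c - b) n / poch c n := by
  have key : ∀ n k : ℕ, poch (-(n : ℝ)) k / k.factorial = (-1) ^ k * (n.choose k : ℝ) := by
    intro n k
    induction k generalizing n with
    | zero => simp [poch_zero]
    | succ k ih =>
      rcases n with _ | n
      · simp [poch_succ_left]
      · have h1 : (-((n + 1 : ℕ) : ℝ) + 1) = -(n : ℝ) := by push_cast; ring
        have h2 := Nat.add_one_mul_choose_eq n k
        have h3 : ((n : ℝ) + 1) * n.choose k = (n + 1).choose (k + 1) * (k + 1) := by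
          exact_mod_cast h2
        have h4 := ih n
        have hk : (k.factorial : ℝ) ≠ 0 := by positivity
        rw [poch_succ_left, h1, Nat.factorial_succ]
        rw [div_eq_iff hk] at h4
        rw [h4]
        push_cast
        have : (k : ℝ) + 1 ≠ 0 := by positivity
        field_simp
        rw [pow_succ]
        linear_combination (-(-1 : ℝ) ^ k) * h3
  have key' : ∀ (n : ℕ) (b c : ℝ),
      ∑ k ∈ Finset.range (n + 1), poch (-(n : ℝ)) k * poch b k / (poch c k * k.factorial) =
      ∑ k ∈ Finset.range (n + 1), (-1) ^ k * (n.choose k : ℝ) * (poch b k / poch c k) := by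
    intro n b c
    refine Finset.sum_congr rfl fun k _ => ?_
    rw [← key]; ring
  induction n with
  | zero => intro b c _; simp [poch_zero]
  | succ n ih =>
    intro b c hc
    have hc0 : c ≠ 0 := by simpa using hc 0 (by omega)
    have hcn : c + n ≠ 0 := hc n (by omega)
    have e1 := ih b c fun i hi => hc i (by omega)
    have e2 := ih (b + 1) (c + 1) fun i hi => by
      have := hc (i + 1) (by omega); push_cast at this; convert this using 1; ring
    rw [key'] at e1 e2 ⊢
    -- Pascal's rule splits the sum for $n+1$ into the sum for $n$ with parameters $(b,c)$ and
    -- $-b/c$ times the sum for $n$ with $(b+1,c+1)$. This is why the induction quantifies over $b$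
    -- and $c$; both closed forms contain the same $(c-b)_n$.
    have hstep : ∑ k ∈ Finset.range (n + 1 + 1),
        (-1) ^ k * ((n + 1).choose k : ℝ) * (poch b k / poch c k) =
        ∑ k ∈ Finset.range (n + 1), (-1) ^ k * (n.choose k : ℝ) * (poch b k / poch c k) -
        b / c * ∑ k ∈ Finset.range (n + 1),
          (-1) ^ k * (n.choose k : ℝ) * (poch (b + 1) k / poch (c + 1) k) := by
      rw [Finset.sum_range_succ', Finset.mul_sum]
      have : ∑ k ∈ Finset.range (n + 1), (-1) ^ k * (n.choose k : ℝ) * (poch b k / poch c k) =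
          ∑ k ∈ Finset.range (n + 1),
            (-1) ^ (k + 1) * (n.choose (k + 1) : ℝ) * (poch b (k + 1) / poch c (k + 1)) + 1 := by
        have h := Finset.sum_range_succ'
          (fun k => (-1 : ℝ) ^ k * (n.choose k : ℝ) * (poch b k / poch c k)) (n + 1)
        rw [Finset.sum_range_succ] at h
        simpa [poch_zero] using h
      rw [this]
      simp only [Nat.choose_zero_right, poch_zero]
      have h2 : ∀ k, (-1 : ℝ) ^ (k + 1) * ((n + 1).choose (k + 1) : ℝ) *
          (poch b (k + 1) / poch c (k + 1)) =
          (-1) ^ (k + 1) * (n.choose (k + 1) : ℝ) * (poch b (k + 1) / poch c (k + 1)) -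
          b / c * ((-1) ^ k * (n.choose k : ℝ) * (poch (b + 1) k / poch (c + 1) k)) := by
        intro k
        rw [Nat.choose_succ_succ, poch_succ_left b, poch_succ_left c, mul_div_mul_comm]
        push_cast; ring
      simp only [h2, Finset.sum_sub_distrib]
      norm_num
      ring
    rw [hstep, e1, e2]
    have h1 : poch c n ≠ 0 := poch_ne_zero fun i hi => hc i (by omega)
    have h2 : poch (c + 1) n ≠ 0 := poch_ne_zero fun i hi => by
      have := hc (i + 1) (by omega); push_cast at this; convert this using 1; ring
    have h3 := poch_shift c (c + 1) rfl n
    have h4 : c + 1 - (b + 1) = c - b := by ring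
    rw [h4, poch_succ, poch_succ]
    have h5 : b / c * (poch (c - b) n / poch (c + 1) n) =
        b * poch (c - b) n / (poch c n * (c + n)) := by
      rw [h3]; field_simp
    rw [h5]
    field_simp
    ring

end Pochhammer

/-! ### The recurrence, its uniqueness property, and the telescoping certificate. -/

section Recurrence

/-- The array `c` moved down by one row. -/
def shiftRow (c : ℕ → ℕ → ℝ) : ℕ → ℕ → ℝ
  | 0, _ => 0
  | m + 1, n => c m n

/-- The coefficient of `c m n` in the recurrence, with `N = l₁₃` and `b = l₂₃`. -/
def recDiag (N b g m n : ℝ) : ℝ :=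
  2 * m ^ 2 + 2 * m * n + n ^ 2 + (N + b - 2 * m - n) ^ 2 + 2 * g * n - N * (N + 2 * g) - b ^ 2

/-- The coefficient of `c m n` in the recurrence at `(m, n - 1)`. -/
def recUp (N b g m n : ℝ) : ℝ :=
  -6 * m * n - 4 * n ^ 2 + 2 * n + 2 * (N + b) * n - 6 * g * n - 6 * g * m + 2 * (N + b) * g

/-- The coefficient of `c m n` in the recurrence at `(m + 1, n - 1)`. -/
def recSide (N b g m n : ℝ) : ℝ :=
  6 * m * n + 2 * n ^ 2 + 2 * n - 2 * (N + b) * n + 6 * g * m - 2 * (N + b) * g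

/-- The recurrence for the coefficients in the basis `u ^ m v ^ n` of an eigenfunction of `H_g`,
where `u = x₁x₂/x₃²` and `v = (1 - x₁/x₃)(1 - x₂/x₃)`. -/
def Recurrence (N b g : ℝ) (c : ℕ → ℕ → ℝ) : Prop :=
  ∀ m n : ℕ, recDiag N b g m n * c m n + recUp N b g m (n + 1) * c m (n + 1) +
    recSide N b g (m - 1) (n + 1) * shiftRow c m (n + 1) +
    2 * (n + 2) * (n + 1 + 2 * g) *
      (c m (n + 2) - 2 * shiftRow c m (n + 2) + shiftRow (shiftRow c) m (n + 2)) = 0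

/-- The relation at `(m, n)` expresses `c m n` through entries of row `m` with larger `n` and
entries of rows `m - 1`, `m - 2`, as long as its own coefficient is nonzero. So the array is
determined by increasing `m` and, within a row, decreasing `n`, starting from the zeros above total
degree `N`. The only position in the triangle where division may fail is `(0, N)`, whose value is
prescribed. -/
theorem Recurrence.eq_of_irrational {N b : ℕ} {g : ℝ} (hg : Irrational g) {c c' : ℕ → ℕ → ℝ}
    (hc : Recurrence N b g c) (hc' : Recurrence N b g c')
    (h0 : ∀ m n, N < m + n → c m n = 0) (h0' : ∀ m n, N < m + n → c' m n = 0)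
    (htop : c 0 N = c' 0 N) (m n : ℕ) : c m n = c' m n := by
  induction m using Nat.strong_induction_on generalizing n with
  | _ m ihm =>
    have hrow : ∀ n, shiftRow c m n = shiftRow c' m n := by
      intro n
      rcases m with _ | m
      · rfl
      · exact ihm m (by omega) n
    have hrow2 : ∀ n, shiftRow (shiftRow c) m n = shiftRow (shiftRow c') m n := by
      intro n
      rcases m with _ | _ | m
      · rfl
      · rfl
      · exact ihm m (by omega) n
    have main : ∀ j n : ℕ, N < n + j → c m n = c' m n := by
      intro j
      induction j with
      | zero => intro n hn; rw [h0 m n (by omega), h0' m n (by omega)]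
      | succ j ihj =>
        intro n hn
        by_cases hmn : N < m + n
        · rw [h0 m n hmn, h0' m n hmn]
        by_cases hnN : n = N
        · have : m = 0 := by omega
          subst this; rw [hnN, htop]
        have h1 := hc m n
        have h2 := hc' m n
        rw [ihj (n + 1) (by omega), ihj (n + 2) (by omega), hrow, hrow, hrow2] at h1
        -- The part of `recDiag` containing `g` is $2(n-N)g$ and the rest is an integer, so for
        -- $n\ne N$ irrationality of `g` excludes a zero.
        have hD : recDiag N b g m n ≠ 0 := by
          intro h
          have hirr : Irrational (((2 * ((n : ℤ) - N) : ℤ) : ℝ) * g) :=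
            hg.intCast_mul (by omega)
          refine hirr.ne_int (-(2 * (m : ℤ) ^ 2 + 2 * m * n + n ^ 2 +
            ((N : ℤ) + b - 2 * m - n) ^ 2 - N * N - b ^ 2)) ?_
          unfold recDiag at h
          push_cast
          linear_combination h
        have h3 : recDiag N b g m n * (c m n - c' m n) = 0 := by linear_combination h1 - h2
        rcases mul_eq_zero.1 h3 with h | h
        · exact absurd h hD
        · linarith
    exact main (N + 1) n (by omega)

theorem Recurrence.const_mul {N b g : ℝ} {c : ℕ → ℕ → ℝ} (hc : Recurrence N b g c) (K : ℝ) :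
    Recurrence N b g fun m n => K * c m n := by
  intro m n
  have h := hc m n
  have h1 : ∀ n, shiftRow (fun m n => K * c m n) m n = K * shiftRow c m n := by
    intro n; cases m <;> simp [shiftRow]
  have h2 : ∀ n, shiftRow (shiftRow fun m n => K * c m n) m n =
      K * shiftRow (shiftRow c) m n := by
    intro n; rcases m with _ | _ | m <;> simp [shiftRow]
  rw [h1, h1, h2]
  linear_combination K * h

/-- The polynomial factor of the certificate of creative telescoping. -/
def certPoly (N b g m n k : ℝ) : ℝ :=
  -recDiag N b g m n * (2 * g + n) * k +
  (2*m*n^3 + 6*m^2*n^2 - 2*m^3 + 4*m^3*n - 2*g*n^3 + 6*g*m^2 + 12*g*m^2*n + 6*g*m^3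
    - 6*g^2*n^2 - 4*g^2*m - 12*g^2*m*n + 6*g^2*m^2 - 4*g^3*n - 12*g^3*m - 2*b*m*n^2 + 2*b*m^2
    - 2*b*m^2*n + 2*b*g*n^2 - 4*b*g*m - 4*b*g*m*n - 2*b*g*m^2 + 4*b*g^2*n - 4*b*g^2*m
    - 2*N*m*n^2 + 2*N*m^2 - 2*N*m^2*n + 2*N*g*n^2 - 2*N*g*m - 4*N*g*m*n - 2*N*g*m^2
    + 6*N*g^2*n - 2*N*g^2*m + 4*N*g^3 - 2*N*b*m - 2*N*b*g*n - 2*N*b*g*m - 4*N*b*g^2)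

/-- This is the telescoping relation divided by the summand at `(m, n, k)`: every shifted summand is
replaced by its rational ratio, and the denominators are cleared. What remains is a polynomial
identity, and `certPoly` has degree at most one in `k`. -/
theorem certPoly_identity (N b g m n k : ℝ) :
    recDiag N b g m n * ((n + 1) * (2 * g + n)) * (k - 2 * g - (m + n)) *
        (k - 2 * g - (m + n) - 1) * (k + g - m) * (k + g - m + 1) +
      recUp N b g m (n + 1) * (-(m + n - N) * (m + n + g - b) * (m + n + 2 * g)) *
        (k - 2 * g - (m + n) - 1) * (k + g - m) * (k + g - m + 1) +
      recSide N b g (m - 1) (n + 1) * (-(m - 2 * g - N) * (m - g - b) * m) *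
        (k - 2 * g - (m + n)) * (k - 2 * g - (m + n) - 1) * (k + g - m + 1) +
      2 * ((-(m + n - N) * (m + n + g - b) * (m + n + 2 * g)) *
          (-(m + n + 1 - N) * (m + n + 1 + g - b) * (m + n + 1 + 2 * g)) *
          (k + g - m) * (k + g - m + 1) -
        2 * ((-(m + n - N) * (m + n + g - b) * (m + n + 2 * g)) *
          (-(m - 2 * g - N) * (m - g - b) * m) *
          (k - 2 * g - (m + n) - 1) * (k + g - m + 1)) +
        (-(m - 2 * g - N) * (m - g - b) * m) *
          (-(m - 1 - 2 * g - N) * (m - 1 - g - b) * (m - 1)) *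
          (k - 2 * g - (m + n)) * (k - 2 * g - (m + n) - 1)) =
    certPoly N b g m n (k + 1) * ((k - b) * (k + g) * (k - g - N) * (k - 2 * g - (m + n) - 1)) -
      certPoly N b g m n k * (k * (k - g - b) * (k - 2 * g - N) * (k + g - m + 1)) := by
  unfold certPoly recDiag recUp recSide
  ring

end Recurrence

/-! ### Creative telescoping for an abstract summand. -/

section Telescoping

/-- One step of creative telescoping: the terms `tᵢⱼ = T (m - i) (n + j)` at `k`, combined with the
coefficients of the recurrence, are a difference in `k`. -/
theorem telescoping_step {N b g m n k t00 t01 t11 t02 t12 t22 t' : ℝ}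
    (hn1 : n + 1 ≠ 0) (hn2 : n + 2 ≠ 0)
    (hg0 : 2 * g + n ≠ 0) (hg1 : 2 * g + n + 1 ≠ 0)
    (ha0 : k - 2 * g - (m + n) ≠ 0) (ha1 : k - 2 * g - (m + n) - 1 ≠ 0)
    (ha' : k + 1 - 2 * g - (m + n) ≠ 0) (hb0 : k + g - m ≠ 0) (hb1 : k + g - m + 1 ≠ 0)
    (h01 : t01 * ((n + 1) * (2 * g + n)) * (k - 2 * g - (m + n)) =
      -(m + n - N) * (m + n + g - b) * (m + n + 2 * g) * t00)
    (h11 : t11 * ((n + 1) * (2 * g + n)) * (k + g - m) =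
      -(m - 2 * g - N) * (m - g - b) * m * t00)
    (h02 : t02 * ((n + 2) * (2 * g + n + 1)) * (k - 2 * g - (m + n) - 1) =
      -(m + n + 1 - N) * (m + n + 1 + g - b) * (m + n + 1 + 2 * g) * t01)
    (h12 : t12 * ((n + 2) * (2 * g + n + 1)) * (k + g - m) =
      -(m - 2 * g - N) * (m - g - b) * m * t01)
    (h22 : t22 * ((n + 2) * (2 * g + n + 1)) * (k + g - m + 1) =
      -(m - 1 - 2 * g - N) * (m - 1 - g - b) * (m - 1) * t11)
    (hk : t' * ((k + 1) * (k + 1 - g - b) * (k + 1 - 2 * g - N) * (k + g - m)) =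
      (k - b) * (k + g) * (k - g - N) * (k + 1 - 2 * g - (m + n)) * t00) :
    recDiag N b g m n * t00 + recUp N b g m (n + 1) * t01 + recSide N b g (m - 1) (n + 1) * t11 +
      2 * (n + 2) * (n + 1 + 2 * g) * (t02 - 2 * t12 + t22) =
    certPoly N b g m n (k + 1) * ((k + 1) * (k + 1 - g - b) * (k + 1 - 2 * g - N)) * t' /
        ((n + 1) * (2 * g + n) * ((k + 1 - 2 * g - (m + n)) * (k + 1 - 2 * g - (m + n) - 1) *
          (k + 1 + g - m))) -
      certPoly N b g m n k * (k * (k - g - b) * (k - 2 * g - N)) * t00 /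
        ((n + 1) * (2 * g + n) * ((k - 2 * g - (m + n)) * (k - 2 * g - (m + n) - 1) *
          (k + g - m))) := by
  have key := certPoly_identity N b g m n k
  generalize certPoly N b g m n (k + 1) = C1 at key ⊢
  generalize certPoly N b g m n k = C0 at key ⊢
  generalize recDiag N b g m n = D at key ⊢
  generalize recUp N b g m (n + 1) = U at key ⊢
  generalize recSide N b g (m - 1) (n + 1) = V at key ⊢
  -- The certificate at `k + 1` carries exactly the factors that the term ratio in `k` divides by,
  -- so its summand can be traded for `t00`.
  have ht' : (k + 1) * (k + 1 - g - b) * (k + 1 - 2 * g - N) * t' =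
      (k - b) * (k + g) * (k - g - N) * (k + 1 - 2 * g - (m + n)) * t00 / (k + g - m) := by
    rw [eq_div_iff hb0]; linear_combination hk
  have e1 : k + 1 - 2 * g - (m + n) - 1 = k - 2 * g - (m + n) := by ring
  have e2 : k + 1 + g - m = k + g - m + 1 := by ring
  have e3 : n + 1 + 2 * g = 2 * g + n + 1 := by ring
  rw [mul_assoc C1, ht', e1, e2, e3]
  -- All remaining factors become atoms: every term is a multiple of `t00` by a ratio of them, and
  -- `key` is the cleared identity in the same atoms.
  generalize -(m + n - N) * (m + n + g - b) * (m + n + 2 * g) = s0 at *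
  generalize -(m + n + 1 - N) * (m + n + 1 + g - b) * (m + n + 1 + 2 * g) = s1 at *
  generalize -(m - 2 * g - N) * (m - g - b) * m = r0 at *
  generalize -(m - 1 - 2 * g - N) * (m - 1 - g - b) * (m - 1) = r1 at *
  generalize (k - b) * (k + g) * (k - g - N) = w at *
  generalize k * (k - g - b) * (k - 2 * g - N) = z at *
  generalize k - 2 * g - (m + n) - 1 = a1 at *
  generalize k - 2 * g - (m + n) = a0 at *
  generalize k + 1 - 2 * g - (m + n) = a' at *
  generalize k + g - m + 1 = b1 at *
  generalize k + g - m = b0 at *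
  generalize 2 * g + n + 1 = p1 at *
  generalize 2 * g + n = p0 at *
  have E01 : t01 = s0 * t00 / ((n + 1) * p0 * a0) := by
    rw [eq_div_iff (by positivity)]; linear_combination h01
  have E11 : t11 = r0 * t00 / ((n + 1) * p0 * b0) := by
    rw [eq_div_iff (by positivity)]; linear_combination h11
  have E02 : t02 = s1 * t01 / ((n + 2) * p1 * a1) := by
    rw [eq_div_iff (by positivity)]; linear_combination h02
  have E12 : t12 = r0 * t01 / ((n + 2) * p1 * b0) := by
    rw [eq_div_iff (by positivity)]; linear_combination h12
  have E22 : t22 = r1 * t11 / ((n + 2) * p1 * b1) := by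
    rw [eq_div_iff (by positivity)]; linear_combination h22
  rw [E02, E12, E22, E01, E11]
  clear E01 E11 E02 E12 E22 h01 h11 h02 h12 h22 hk ht' e1 e2 e3
  field_simp
  linear_combination t00 * key

/-- The summand enters only through its three ratios, with the summation variable `k` displaced by
`δ`. Summing the telescoping relation leaves two boundary terms. The upper one vanishes with `T m n
K`. The lower one contains $\delta(\delta-g-b)$, and its two roots $0$ and $g+b$ give the two
formulas. The integrality conditions keep the denominators of ratios and certificate away from zero.
-/
theorem recurrence_of_telescoping {N b g δ : ℝ} {K : ℕ} {T : ℕ → ℕ → ℕ → ℝ}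
    (h1 : ∀ m n k : ℕ, T m (n + 1) k * ((n + 1) * (2 * g + n)) * (k + δ - 2 * g - (m + n)) =
      -(m + n - N) * (m + n + g - b) * (m + n + 2 * g) * T m n k)
    (h2 : ∀ m n k : ℕ, T m (n + 1) k * ((n + 1) * (2 * g + n)) * (k + δ + g - (m + 1)) =
      -(m + 1 - 2 * g - N) * (m + 1 - g - b) * (m + 1) * T (m + 1) n k)
    (h3 : ∀ m n k : ℕ, T m n (k + 1) * ((k + δ + 1) * (k + δ + 1 - g - b) *
        (k + δ + 1 - 2 * g - N) * (k + δ + g - m)) =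
      (k + δ - b) * (k + δ + g) * (k + δ - g - N) * (k + δ + 1 - 2 * g - (m + n)) * T m n k)
    (hδ : δ * (δ - g - b) = 0) (hK : ∀ m n, T m n K = 0)
    (hg : ∀ z : ℤ, 2 * g + z ≠ 0) (hA : ∀ z : ℤ, δ - 2 * g + z ≠ 0)
    (hB : ∀ z : ℤ, δ + g + z ≠ 0) :
    Recurrence N b g fun m n => ∑ k ∈ Finset.range K, T m n k := by
  intro m n
  have s1 : ∀ n, shiftRow (fun m n => ∑ k ∈ Finset.range K, T m n k) m n =
      ∑ k ∈ Finset.range K, shiftRow (fun m n => T m n k) m n := by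
    intro n; cases m <;> simp [shiftRow]
  have s2 : ∀ n, shiftRow (shiftRow fun m n => ∑ k ∈ Finset.range K, T m n k) m n =
      ∑ k ∈ Finset.range K, shiftRow (shiftRow fun m n => T m n k) m n := by
    intro n; rcases m with _ | _ | m <;> simp [shiftRow]
  -- The ratio relation survives at the edge `m = 0`, where the shifted array is zero by convention,
  -- because the other side has the factor `m`. The factor `m - 1` plays the same role at `m = 1`
  -- for the double shift below.
  have h2' : ∀ n k : ℕ, shiftRow (fun m n => T m n k) m (n + 1) * ((n + 1) * (2 * g + n)) *
      (k + δ + g - m) = -(m - 2 * g - N) * (m - g - b) * m * T m n k := by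
    intro n k
    rcases m with _ | m
    · simp [shiftRow]
    · simpa [shiftRow] using h2 m n k
  have h2'' : ∀ n k : ℕ, shiftRow (shiftRow fun m n => T m n k) m (n + 1) *
      ((n + 1) * (2 * g + n)) * (k + δ + g - m + 1) =
      -(m - 1 - 2 * g - N) * (m - 1 - g - b) * (m - 1) * shiftRow (fun m n => T m n k) m n := by
    intro n k
    rcases m with _ | _ | m
    · simp [shiftRow]
    · simp [shiftRow]
    · have := h2 m n k
      simp only [shiftRow]
      push_cast
      linear_combination this
  simp only [s1, s2]
  have step : ∀ k : ℕ, _ := fun k => telescoping_step (N := N) (b := b) (g := g) (m := m) (n := n)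
    (k := k + δ) (t00 := T m n k) (t01 := T m (n + 1) k)
    (t11 := shiftRow (fun m n => T m n k) m (n + 1)) (t02 := T m (n + 2) k)
    (t12 := shiftRow (fun m n => T m n k) m (n + 2))
    (t22 := shiftRow (shiftRow fun m n => T m n k) m (n + 2)) (t' := T m n (k + 1))
    (by positivity) (by positivity)
    (by have := hg n; push_cast at this; exact this)
    (by have := hg (n + 1); push_cast at this; rwa [← add_assoc] at this)
    (by have := hA (k - m - n); push_cast at this; convert this using 1; ring)
    (by have := hA (k - m - n - 1); push_cast at this; convert this using 1; ring)
    (by have := hA (k + 1 - m - n); push_cast at this; convert this using 1; ring)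
    (by have := hB (k - m); push_cast at this; convert this using 1; ring)
    (by have := hB (k - m + 1); push_cast at this; convert this using 1; ring)
    (h1 m n k) (h2' n k)
    (by have := h1 m (n + 1) k; push_cast at this; linear_combination this)
    (by have := h2' (n + 1) k; push_cast at this; linear_combination this)
    (by have := h2'' (n + 1) k; push_cast at this; linear_combination this)
    (h3 m n k)
  let G : ℕ → ℝ := fun k => certPoly N b g m n (k + δ) *
    ((k + δ) * (k + δ - g - b) * (k + δ - 2 * g - N)) * T m n k /
        ((n + 1) * (2 * g + n) * ((k + δ - 2 * g - (m + n)) * (k + δ - 2 * g - (m + n) - 1) *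
          (k + δ + g - m)))
  have hsum := Finset.sum_range_sub G K
  have hG0 : G 0 = 0 := by
    have : certPoly N b g m n (0 + δ) *
        ((0 + δ) * (0 + δ - g - b) * (0 + δ - 2 * g - N)) * T m n 0 = 0 := by
      linear_combination certPoly N b g m n (0 + δ) * (δ - 2 * g - N) * T m n 0 * hδ
    simp only [G, Nat.cast_zero, this, zero_div]
  have hGK : G K = 0 := by simp [G, hK]
  rw [hG0, hGK, sub_zero] at hsum
  rw [← hsum]
  simp only [Finset.mul_sum, ← Finset.sum_add_distrib, ← Finset.sum_sub_distrib]
  refine Finset.sum_congr rfl fun k _ => ?_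
  have e : ((k + 1 : ℕ) : ℝ) + δ = (k : ℝ) + δ + 1 := by push_cast; ring
  simp only [G, e]
  exact step k

end Telescoping

/-! ### The summands of the two hypergeometric formulas. -/

section Coefficients

/-- The common shape of the summands of `firstCoeff` and `secondCoeff`, without the prefactors. -/
noncomputable def coeffTerm (N b g σ ρ χ w₁ w₂ w₃ v₁ v₂ : ℝ) (m n k : ℕ) : ℝ :=
  poch (-N) (m + n) * poch σ (m + n) * poch (ρ - m - n) k *
    (poch (1 - χ) m / (poch (1 - 2 * g - N) m * poch (1 - g - b) m * m.factorial *
      poch (χ - m) k)) *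
    (1 / (poch (2 * g) n * n.factorial)) *
    (poch w₁ k * poch w₂ k * poch w₃ k / (poch v₁ k * poch v₂ k * k.factorial))

theorem poch_ne_zero_of_int {a : ℝ} (h : ∀ z : ℤ, a + z ≠ 0) (n : ℕ) : poch a n ≠ 0 :=
  poch_ne_zero fun i _ => by exact_mod_cast h i

/-- Both formulas have summands with the term ratios required for telescoping. The Pochhammer
parameters matter only through the products in `hσ`, `hw`, `hv`, which are symmetric enough to be
met at both values of `δ`. For instance, the roles of `s + g - b` and `s + 2 * g` in `hσ` are
exchanged between the two cases. -/
theorem recurrence_coeffTerm {N b g σ ρ χ w₁ w₂ w₃ v₁ v₂ δ : ℝ} {K : ℕ}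
    (hρ : ρ = 1 - 2 * g + δ) (hχ : χ = g + δ)
    (hσ : ∀ s : ℝ, (σ + s) * (ρ - 1 - s) = -((s + g - b) * (s + 2 * g)))
    (hw : ∀ k : ℝ, (w₁ + k) * (w₂ + k) * (w₃ + k) =
      (k + δ - b) * (k + δ + g) * (k + δ - g - N))
    (hv : ∀ k : ℝ, (v₁ + k) * (v₂ + k) * (k + 1) =
      (k + δ + 1) * (k + δ + 1 - g - b) * (k + δ + 1 - 2 * g - N))
    (hδ : δ * (δ - g - b) = 0) (hK : poch w₁ K = 0)
    (hg : ∀ z : ℤ, 2 * g + z ≠ 0) (hgN : ∀ z : ℤ, 1 - 2 * g - N + z ≠ 0)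
    (hgb : ∀ z : ℤ, 1 - g - b + z ≠ 0)
    (hρ' : ∀ z : ℤ, ρ + z ≠ 0) (hχ' : ∀ z : ℤ, χ + z ≠ 0)
    (hv₁ : ∀ z : ℤ, v₁ + z ≠ 0) (hv₂ : ∀ z : ℤ, v₂ + z ≠ 0) :
    Recurrence N b g fun m n =>
      ∑ k ∈ Finset.range K, coeffTerm N b g σ ρ χ w₁ w₂ w₃ v₁ v₂ m n k := by
  have hV : ∀ n : ℕ, 1 / (poch (2 * g) (n + 1) * (n + 1).factorial) * ((n + 1) * (2 * g + n)) =
      1 / (poch (2 * g) n * n.factorial) := by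
    intro n
    have p1 := poch_ne_zero_of_int hg n
    have p2 : 2 * g + n ≠ 0 := by exact_mod_cast hg n
    rw [poch_succ, Nat.factorial_succ]; push_cast
    field_simp
  have hχm : ∀ (m : ℕ) (z : ℤ), χ - m + z ≠ 0 := fun m z => by
    have := hχ' (-m + z); push_cast at this; convert this using 1; ring
  -- Shifting the base of $(\chi-m)_k$ produces the factor $\chi-m-1$, which is minus the new factor
  -- of $(1-\chi)_{m+1}$. This cancellation is the reason for the numerator $(1-\chi)_m$.
  have hM : ∀ m k : ℕ, poch (1 - χ) m / (poch (1 - 2 * g - N) m * poch (1 - g - b) m *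
      m.factorial * poch (χ - m) k) * (k + δ + g - (m + 1)) =
      -(m + 1 - 2 * g - N) * (m + 1 - g - b) * (m + 1) *
      (poch (1 - χ) (m + 1) / (poch (1 - 2 * g - N) (m + 1) * poch (1 - g - b) (m + 1) *
      (m + 1).factorial * poch (χ - (m + 1 : ℕ)) k)) := by
    intro m k
    have q := poch_shift (χ - (m + 1 : ℕ)) (χ - m) (by push_cast; ring) k
    have p0 := poch_ne_zero_of_int hgN m
    have p1 := poch_ne_zero_of_int hgb m
    have p2 := poch_ne_zero_of_int (hχm m) k
    have p3 := poch_ne_zero_of_int (hχm (m + 1)) k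
    have p7 : 1 - 2 * g - N + m ≠ 0 := by exact_mod_cast hgN m
    have p8 : 1 - g - b + m ≠ 0 := by exact_mod_cast hgb m
    rw [poch_succ (1 - χ), poch_succ (1 - 2 * g - N), poch_succ (1 - g - b), Nat.factorial_succ]
    have e : (k : ℝ) + δ + g - (m + 1) = χ - (m + 1 : ℕ) + k := by push_cast; rw [hχ]; ring
    rw [e]
    generalize poch (χ - m) k = Q' at *
    generalize poch (χ - (m + 1 : ℕ)) k = Q at *
    push_cast at q ⊢
    have e1 : (m : ℝ) + 1 - 2 * g - N = 1 - 2 * g - N + m := by ring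
    have e2 : (m : ℝ) + 1 - g - b = 1 - g - b + m := by ring
    rw [e1, e2]
    generalize 1 - 2 * g - N + (m : ℝ) = x at *
    generalize 1 - g - b + (m : ℝ) = y at *
    have p4 : (m : ℝ) + 1 ≠ 0 := by positivity
    field_simp
    linear_combination poch (1 - χ) m * q
  refine recurrence_of_telescoping (δ := δ) ?_ ?_ ?_ hδ ?_ hg
    (fun z => by have := hρ' (z - 1); push_cast at this; rw [hρ] at this; convert this using 1; ring)
    (fun z => by have := hχ' z; rw [hχ] at this; convert this using 1; ring)
  · intro m n k
    have q := poch_shift (ρ - m - (n + 1 : ℕ)) (ρ - m - n) (by push_cast; ring) k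
    have hs := hσ (m + n)
    unfold coeffTerm
    rw [← hV n, ← add_assoc, poch_succ, poch_succ]
    generalize poch (1 - χ) m / _ = M
    generalize 1 / (poch (2 * g) (n + 1) * (n + 1).factorial : ℝ) = V
    generalize _ / (poch v₁ k * poch v₂ k * k.factorial) = W
    generalize poch (ρ - m - (n + 1 : ℕ)) k = Q at *
    generalize poch (ρ - m - n) k = Q' at *
    push_cast at q ⊢
    generalize poch (-N) (m + n) = X
    generalize poch σ (m + n) = Y
    have e : (k : ℝ) + δ - 2 * g - (m + n) = ρ - m - (n + 1) + k := by rw [hρ]; ring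
    rw [e]
    linear_combination (X * Y * M * V * W * (n + 1) * (2 * g + n) * (-N + (m + n))) *
      ((σ + (m + n)) * q + Q' * hs)
  · intro m n k
    have h1 := hV n
    have h2 := hM m k
    have e1 : m + 1 + n = m + (n + 1) := by ring
    have e2 : ρ - (m + 1 : ℕ) - n = ρ - m - (n + 1 : ℕ) := by push_cast; ring
    unfold coeffTerm
    rw [e1, e2, ← h1]
    linear_combination (poch (-N) (m + (n + 1)) * poch σ (m + (n + 1)) *
      poch (ρ - m - (n + 1 : ℕ)) k *
      (1 / (poch (2 * g) (n + 1) * (n + 1).factorial) * ((n + 1) * (2 * g + n))) *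
      (poch w₁ k * poch w₂ k * poch w₃ k / (poch v₁ k * poch v₂ k * k.factorial))) * h2
  · intro m n k
    have p2 := poch_ne_zero_of_int (hχm m) k
    have p4 := poch_ne_zero_of_int hv₁ k
    have p5 := poch_ne_zero_of_int hv₂ k
    have p7 : v₁ + k ≠ 0 := by exact_mod_cast hv₁ k
    have p8 : v₂ + k ≠ 0 := by exact_mod_cast hv₂ k
    have p9 : χ - m + k ≠ 0 := by exact_mod_cast hχm m k
    have e1 : (k : ℝ) + δ + g - m = χ - m + k := by rw [hχ]; ring
    have e2 : (k : ℝ) + δ + 1 - 2 * g - (m + n) = ρ - m - n + k := by rw [hρ]; ring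
    have hM' : poch (1 - χ) m / (poch (1 - 2 * g - N) m * poch (1 - g - b) m *
        m.factorial * poch (χ - m) (k + 1)) * (χ - m + k) =
        poch (1 - χ) m / (poch (1 - 2 * g - N) m * poch (1 - g - b) m *
        m.factorial * poch (χ - m) k) := by
      rw [poch_succ (χ - m), ← mul_assoc, div_mul_eq_mul_div, mul_div_mul_right _ _ p9]
    have hW' : poch w₁ (k + 1) * poch w₂ (k + 1) * poch w₃ (k + 1) /
        (poch v₁ (k + 1) * poch v₂ (k + 1) * (k + 1).factorial) *
        ((v₁ + k) * (v₂ + k) * (k + 1)) = (w₁ + k) * (w₂ + k) * (w₃ + k) *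
        (poch w₁ k * poch w₂ k * poch w₃ k / (poch v₁ k * poch v₂ k * k.factorial)) := by
      simp only [poch_succ, Nat.factorial_succ]
      push_cast
      field_simp
    rw [← hw, ← hv, e1, e2]
    unfold coeffTerm
    rw [← hM', poch_succ (ρ - m - n)]
    generalize poch (1 - χ) m / _ = M
    linear_combination (poch (-N) (m + n) * poch σ (m + n) * poch (ρ - m - n) k *
      (ρ - m - n + k) * M * (χ - m + k) * (1 / (poch (2 * g) n * n.factorial))) * hW'
  · intro m n
    simp [coeffTerm, hK]

/-- The summand of `firstCoeff` without its prefactor, with `N = l₁₃` and `b = l₂₃`. -/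
noncomputable def firstTerm (N b : ℕ) (g : ℝ) : ℕ → ℕ → ℕ → ℝ :=
  coeffTerm N b g (g - b) (1 - 2 * g) g (-b) g (-g - N) (1 - g - b) (1 - 2 * g - N)

/-- The summand of `secondCoeff` without its prefactor, with `a = l₁₂`, `b = l₂₃`. -/
noncomputable def secondTerm (a b : ℕ) (g : ℝ) : ℕ → ℕ → ℕ → ℝ :=
  coeffTerm (a + b : ℕ) b g (2 * g) (1 - g + b) (2 * g + b) (-a) g (2 * g + b) (1 + g + b)
    (1 - g - a)

theorem firstCoeff_eq (l : Fin 3 → ℕ) (g : ℝ) (m n : ℕ) :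
    firstCoeff l g m n =
      (poch g (l23 l) * poch (2 * g) (l13 l)) / (poch g (l12 l) * poch (1 - g) (l23 l)) *
        (((l12 l).factorial : ℝ) / ((l13 l).factorial : ℝ)) *
      ∑ k ∈ Finset.range (l23 l + 1), firstTerm (l13 l) (l23 l) g m n k := by
  unfold firstCoeff
  rw [hyp4F3_eq_sum, mul_assoc, mul_assoc]
  congr 1
  rw [Finset.mul_sum, Finset.mul_sum]
  refine Finset.sum_congr rfl fun k _ => ?_
  rw [firstTerm, coeffTerm]
  ring

theorem secondCoeff_eq (l : Fin 3 → ℕ) (hl : l13 l = l12 l + l23 l) (g : ℝ) (m n : ℕ) :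
    secondCoeff l g m n =
      poch g (l13 l + 1) / poch g (l23 l + 1) *
        (((l23 l).factorial : ℝ) / ((l13 l).factorial : ℝ)) *
      ∑ k ∈ Finset.range (l12 l + 1), secondTerm (l12 l) (l23 l) g m n k := by
  have e : 1 - (2 * g + l23 l) = 1 - 2 * g - l23 l := by ring
  unfold secondCoeff
  rw [hyp4F3_eq_sum, mul_assoc, mul_assoc, mul_comm (∑ k ∈ _, _)]
  congr 1
  rw [← mul_assoc, Finset.mul_sum]
  refine Finset.sum_congr rfl fun k _ => ?_
  rw [secondTerm, coeffTerm, ← hl, e]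
  ring

theorem recurrence_firstTerm (N b : ℕ) {g : ℝ} (hg2 : ∀ z : ℤ, 2 * g + z ≠ 0) :
    Recurrence N b g fun m n => ∑ k ∈ Finset.range (b + 1), firstTerm N b g m n k := by
  have hg : ∀ z : ℤ, g + z ≠ 0 := fun z h => hg2 (2 * z) (by push_cast; linear_combination 2 * h)
  have hgN : ∀ z : ℤ, 1 - 2 * g - N + z ≠ 0 := fun z h =>
    hg2 (N - 1 - z) (by push_cast; linear_combination -h)
  have hgb : ∀ z : ℤ, 1 - g - b + z ≠ 0 := fun z h =>
    hg (b - 1 - z) (by push_cast; linear_combination -h)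
  exact recurrence_coeffTerm (δ := 0) (by ring) (by ring) (fun s => by ring) (fun k => by ring)
    (fun k => by ring) (by ring) (poch_neg_natCast_eq_zero (by omega)) hg2 hgN hgb
    (fun z h => hg2 (-1 - z) (by push_cast; linear_combination -h)) hg hgb hgN

/-- The displacement $\delta=b+g$ turns the ratio factors $(k-b)(k+g)(k-g-N)$ of the first summand
into those of the second, since $N=a+b$. The factor $k+1-g-b$ becomes $k+1$, which supplies the
factorial. -/
theorem recurrence_secondTerm (a b : ℕ) {g : ℝ} (hg2 : ∀ z : ℤ, 2 * g + z ≠ 0) :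
    Recurrence (a + b : ℕ) b g
      fun m n => ∑ k ∈ Finset.range (a + 1), secondTerm a b g m n k := by
  have hg : ∀ z : ℤ, g + z ≠ 0 := fun z h => hg2 (2 * z) (by push_cast; linear_combination 2 * h)
  exact recurrence_coeffTerm (δ := b + g) (by ring) (by ring) (fun s => by ring)
    (fun k => by push_cast; ring) (fun k => by push_cast; ring) (by ring)
    (poch_neg_natCast_eq_zero (by omega)) hg2
    (fun z h => hg2 (a + b - 1 - z) (by push_cast at *; linear_combination -h))
    (fun z h => hg (b - 1 - z) (by push_cast; linear_combination -h))
    (fun z h => hg (-b - 1 - z) (by push_cast; linear_combination -h))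
    (fun z h => hg2 (b + z) (by push_cast; linear_combination h))
    (fun z h => hg (b + 1 + z) (by push_cast; linear_combination h))
    (fun z h => hg (a - 1 - z) (by push_cast; linear_combination -h))

end Coefficients

/-! ### The two coefficient arrays: recurrence, normalisation, continuity. -/

section Coefficients

theorem firstCoeff_eq_zero {l : Fin 3 → ℕ} {g : ℝ} {m n : ℕ} (h : l13 l < m + n) :
    firstCoeff l g m n = 0 := by
  simp [firstCoeff, poch_neg_natCast_eq_zero h]

theorem secondCoeff_eq_zero {l : Fin 3 → ℕ} {g : ℝ} {m n : ℕ} (h : l13 l < m + n) :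
    secondCoeff l g m n = 0 := by
  simp [secondCoeff, poch_neg_natCast_eq_zero h]

theorem recurrence_firstCoeff (l : Fin 3 → ℕ) {g : ℝ} (hg2 : ∀ z : ℤ, 2 * g + z ≠ 0) :
    Recurrence (l13 l) (l23 l) g (firstCoeff l g) := by
  have h := (recurrence_firstTerm (l13 l) (l23 l) hg2).const_mul
    ((poch g (l23 l) * poch (2 * g) (l13 l)) / (poch g (l12 l) * poch (1 - g) (l23 l)) *
        (((l12 l).factorial : ℝ) / ((l13 l).factorial : ℝ)))
  convert h using 3
  exact firstCoeff_eq _ _ _ _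

theorem recurrence_secondCoeff {l : Fin 3 → ℕ} (hl : l13 l = l12 l + l23 l) {g : ℝ}
    (hg2 : ∀ z : ℤ, 2 * g + z ≠ 0) :
    Recurrence (l13 l) (l23 l) g (secondCoeff l g) := by
  have h := (recurrence_secondTerm (l12 l) (l23 l) hg2).const_mul
    (poch g (l13 l + 1) / poch g (l23 l + 1) *
        (((l23 l).factorial : ℝ) / ((l13 l).factorial : ℝ)))
  rw [← hl] at h
  convert h using 3
  exact secondCoeff_eq _ hl _ _ _

/-- At $m=0$, $n=N$ two upper parameters coincide with two lower ones ($g=g-m$ and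
$1-2g-m-n=1-2g-N$). The ${}_4F_3$ becomes a terminating ${}_2F_1$ summed by Chu–Vandermonde, and the
prefactor is chosen to leave only the sign. -/
theorem firstCoeff_zero_l13 {l : Fin 3 → ℕ} (hl : l13 l = l12 l + l23 l) {g : ℝ}
    (hg2 : ∀ z : ℤ, 2 * g + z ≠ 0) : firstCoeff l g 0 (l13 l) = (-1) ^ l13 l := by
  have hg : ∀ z : ℤ, g + z ≠ 0 := fun z h => hg2 (2 * z) (by push_cast; linear_combination 2 * h)
  rw [firstCoeff_eq]
  generalize hN : l13 l = N at *
  generalize l12 l = a at *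
  generalize l23 l = b at *
  have c1 : ∀ z : ℤ, 1 - 2 * g - N + z ≠ 0 := fun z h =>
    hg2 (N - 1 - z) (by push_cast; linear_combination -h)
  have c2 : ∀ z : ℤ, 1 - g - b + z ≠ 0 := fun z h =>
    hg (b - 1 - z) (by push_cast; linear_combination -h)
  have c3 : ∀ z : ℤ, 1 - g + z ≠ 0 := fun z h =>
    hg (-1 - z) (by push_cast; linear_combination -h)
  have hNr : (N : ℝ) = a + b := by exact_mod_cast hl
  have hsum : ∑ k ∈ Finset.range (b + 1), firstTerm N b g 0 N k =
      poch (-N) N * poch (g - b) N / (poch (2 * g) N * N.factorial) *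
        ∑ k ∈ Finset.range (b + 1), poch (-(b : ℝ)) k * poch (-g - N) k /
          (poch (1 - g - b) k * k.factorial) := by
    rw [Finset.mul_sum]
    refine Finset.sum_congr rfl fun k _ => ?_
    have p1 := poch_ne_zero_of_int hg k
    have p2 := poch_ne_zero_of_int c1 k
    simp only [firstTerm, coeffTerm, Nat.cast_zero, sub_zero, zero_add, poch_zero,
      Nat.factorial_zero, Nat.cast_one]
    generalize poch (1 - 2 * g - N) k = Q at *
    generalize poch g k = R at *
    field_simp
  have e1 : 1 - g - b - (-g - N) = 1 + (a : ℝ) := by rw [hNr]; ring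
  have h1 := factorial_mul_poch a b
  rw [← hl] at h1
  have h2 := poch_neg g b
  have h3 := poch_neg (1 - g) b
  have e3 : 1 - (1 - g) - (b : ℝ) = g - b := by ring
  rw [e3] at h3
  have h4 : poch (g - b) N = poch (g - b) b * poch g a := by
    rw [hl, add_comm a b, poch_add]; congr 2; ring
  rw [hsum, sum_poch_chu_vandermonde b _ _ fun i _ => by exact_mod_cast c2 i, e1, poch_neg_self,
    h4, h3, h2]
  have p1 := poch_ne_zero_of_int hg a
  have p2 := poch_ne_zero_of_int hg b
  have p3 := poch_ne_zero_of_int hg2 N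
  have p4 := poch_ne_zero_of_int c3 b
  have p5 : (N.factorial : ℝ) ≠ 0 := by positivity
  rw [← h1] at p5 ⊢
  have p6 := left_ne_zero_of_mul p5
  have p7 := right_ne_zero_of_mul p5
  have p8 : ((-1 : ℝ) ^ b) ≠ 0 := by simp
  field_simp

/-- The same collapse as for the first formula: now the cancelling parameters are $2g+b$ and
$1-g+b-N=1-g-a$, leaving ${}_2F_1(-a,g;1+g+b;1)$. -/
theorem secondCoeff_zero_l13 {l : Fin 3 → ℕ} (hl : l13 l = l12 l + l23 l) {g : ℝ}
    (hg2 : ∀ z : ℤ, 2 * g + z ≠ 0) : secondCoeff l g 0 (l13 l) = (-1) ^ l13 l := by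
  have hg : ∀ z : ℤ, g + z ≠ 0 := fun z h => hg2 (2 * z) (by push_cast; linear_combination 2 * h)
  rw [secondCoeff_eq l hl]
  generalize hN : l13 l = N at *
  generalize l12 l = a at *
  generalize l23 l = b at *
  have c1 : ∀ z : ℤ, 2 * g + b + z ≠ 0 := fun z h =>
    hg2 (b + z) (by push_cast; linear_combination h)
  have c2 : ∀ z : ℤ, 1 - g - a + z ≠ 0 := fun z h =>
    hg (a - 1 - z) (by push_cast; linear_combination -h)
  have c3 : ∀ z : ℤ, 1 + g + b + z ≠ 0 := fun z h =>
    hg (b + 1 + z) (by push_cast; linear_combination h)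
  have hNr : (N : ℝ) = a + b := by exact_mod_cast hl
  have e0 : 1 - g + (b : ℝ) - N = 1 - g - a := by rw [hNr]; ring
  have hsum : ∑ k ∈ Finset.range (a + 1), secondTerm a b g 0 N k =
      poch (-N) N / N.factorial *
        ∑ k ∈ Finset.range (a + 1), poch (-(a : ℝ)) k * poch g k /
          (poch (1 + g + b) k * k.factorial) := by
    rw [Finset.mul_sum]
    refine Finset.sum_congr rfl fun k _ => ?_
    have p1 := poch_ne_zero_of_int c1 k
    have p2 := poch_ne_zero_of_int c2 k
    have p3 := poch_ne_zero_of_int hg2 N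
    simp only [secondTerm, coeffTerm, Nat.cast_zero, sub_zero, zero_add, poch_zero,
      Nat.factorial_zero, Nat.cast_one, ← hl, e0]
    field_simp
  have e1 : 1 + g + b - g = 1 + (b : ℝ) := by ring
  have h1 := factorial_mul_poch b a
  rw [add_comm b a, ← hl] at h1
  have h4 : poch g (N + 1) = poch g (b + 1) * poch (1 + g + b) a := by
    rw [hl, show a + b + 1 = b + 1 + a by ring, poch_add]; congr 2; push_cast; ring
  rw [hsum, sum_poch_chu_vandermonde a _ _ fun i _ => by exact_mod_cast c3 i, e1, poch_neg_self,
    h4]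
  have p1 := poch_ne_zero_of_int hg (b + 1)
  have p4 := poch_ne_zero_of_int c3 a
  have p5 : (N.factorial : ℝ) ≠ 0 := by positivity
  rw [← h1] at p5 ⊢
  have p6 := left_ne_zero_of_mul p5
  have p7 := right_ne_zero_of_mul p5
  field_simp

/-! ### Continuity in the coupling constant -/

theorem continuousAt_poch {f : ℝ → ℝ} {g : ℝ} (hf : ContinuousAt f g) (n : ℕ) :
    ContinuousAt (fun t => poch (f t) n) g :=
  (continuous_poch n).continuousAt.comp hf

/-- The coefficient is a finite sum of rational functions of `g`. Within the triangle `m + n ≤ N`, a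
zero of $(1-g)_b$, $(1-g-b)_m$, $(1-g-b)_k$ or $(g-m)_k$ would make `g` an integer at most `N`. The
factors of the symbols with base $1-2g-N$ are strictly negative. -/
theorem continuousAt_firstCoeff (l : Fin 3 → ℕ) (hl : l13 l = l12 l + l23 l) {g : ℝ} (hg : 0 < g)
    (h : ∀ k : ℕ, 1 ≤ k → k ≤ l13 l → g ≠ k) {m n : ℕ} (hmn : m + n ≤ l13 l) :
    ContinuousAt (fun t => firstCoeff l t m n) g := by
  simp only [firstCoeff_eq]
  generalize hN : l13 l = N at *
  generalize l12 l = a at *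
  generalize l23 l = b at *
  have hgz : ∀ z : ℤ, z ≤ N → g ≠ z := by
    intro z hz
    rcases le_or_gt z 0 with h0 | h0
    · have : (z : ℝ) ≤ 0 := by exact_mod_cast h0
      linarith
    · lift z to ℕ using h0.le
      exact_mod_cast h z (by omega) (by omega)
  have q1 : poch (1 - g) b ≠ 0 := poch_ne_zero fun i hi e =>
    hgz (i + 1) (by omega) (by push_cast; linarith)
  have q2 : poch (1 - 2 * g - N) m ≠ 0 := poch_ne_zero fun i hi e => by
    have : (i : ℝ) + 1 ≤ N := by exact_mod_cast (by omega : i + 1 ≤ N)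
    linarith
  have q3 : poch (1 - g - b) m ≠ 0 := poch_ne_zero fun i hi e =>
    hgz (i + 1 - b) (by omega) (by push_cast; linarith)
  refine ContinuousAt.mul (ContinuousAt.mul (ContinuousAt.div ?_ ?_ ?_) continuousAt_const)
    (tendsto_finsetSum _ fun k hk => ?_)
  · exact (continuousAt_poch (by fun_prop) _).mul (continuousAt_poch (by fun_prop) _)
  · exact (continuousAt_poch (by fun_prop) _).mul (continuousAt_poch (by fun_prop) _)
  · exact mul_ne_zero (poch_pos hg _).ne' q1
  have hk' : k ≤ b := by simpa [Nat.lt_succ_iff] using hk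
  have q4 : poch (1 - g - b) k ≠ 0 := poch_ne_zero fun i hi e =>
    hgz (i + 1 - b) (by omega) (by push_cast; linarith)
  have q5 : poch (1 - 2 * g - N) k ≠ 0 := poch_ne_zero fun i hi e => by
    have : (i : ℝ) + 1 ≤ N := by exact_mod_cast (by omega : i + 1 ≤ N)
    linarith
  have q6 : poch (g - m) k ≠ 0 := poch_ne_zero fun i hi e =>
    hgz (m - i) (by omega) (by push_cast; linarith)
  have q7 : poch (2 * g) n ≠ 0 := (poch_pos (by positivity) _).ne'
  have q8 : (m.factorial : ℝ) ≠ 0 := by positivity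
  have q9 : (n.factorial : ℝ) ≠ 0 := by positivity
  have q10 : (k.factorial : ℝ) ≠ 0 := by positivity
  have hp : ∀ (f : ℝ → ℝ) (j : ℕ), Continuous f → ContinuousAt (fun t => poch (f t) j) g :=
    fun f j hf => continuousAt_poch hf.continuousAt j
  have hc : ∀ c : ℝ, ContinuousAt (fun _ : ℝ => c) g := fun c => continuousAt_const
  exact ((((((hp _ _ (by fun_prop)).mul (hp _ _ (by fun_prop))).mul (hp _ _ (by fun_prop))).mul
    ((hp _ _ (by fun_prop)).div ((((hp _ _ (by fun_prop)).mul (hp _ _ (by fun_prop))).mul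
      (hc _)).mul (hp _ _ (by fun_prop)))
      (mul_ne_zero (mul_ne_zero (mul_ne_zero q2 q3) q8) q6))).mul
    ((hc _).div ((hp _ _ (by fun_prop)).mul (hc _)) (mul_ne_zero q7 q9))).mul
    ((((hp _ _ (by fun_prop)).mul (hp _ _ (by fun_prop))).mul (hp _ _ (by fun_prop))).div
      (((hp _ _ (by fun_prop)).mul (hp _ _ (by fun_prop))).mul (hc _))
      (mul_ne_zero (mul_ne_zero q4 q5) q10)))

/-- A zero of $(1-g-b)_m$ or $(2g+b-m)_k$ would make `g`, respectively `2 * g`, an integer at most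
$m-b\le a$, which is why only $\lambda_{12}$ bounds the excluded values. The factors of $(1-g-a)_k$
and $(1-2g-N)_m$ are negative. -/
theorem continuousAt_secondCoeff (l : Fin 3 → ℕ) (hl : l13 l = l12 l + l23 l) {g : ℝ} (hg : 0 < g)
    (h : ∀ k : ℕ, 1 ≤ k → k ≤ l12 l → g ≠ k ∧ 2 * g ≠ k) {m n : ℕ} (hmn : m + n ≤ l13 l) :
    ContinuousAt (fun t => secondCoeff l t m n) g := by
  simp only [secondCoeff_eq l hl]
  generalize hN : l13 l = N at *
  generalize l12 l = a at *
  generalize l23 l = b at *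
  subst hl
  have hgz : ∀ z : ℤ, z ≤ a → g ≠ z ∧ 2 * g ≠ z := by
    intro z hz
    rcases le_or_gt z 0 with h0 | h0
    · have : (z : ℝ) ≤ 0 := by exact_mod_cast h0
      constructor <;> linarith
    · lift z to ℕ using h0.le
      exact_mod_cast h z (by omega) (by omega)
  have q2 : poch (1 - 2 * g - (a + b : ℕ)) m ≠ 0 := poch_ne_zero fun i hi e => by
    have : (i : ℝ) + 1 ≤ (a + b : ℕ) := by exact_mod_cast (by omega : i + 1 ≤ a + b)
    linarith
  have q3 : poch (1 - g - b) m ≠ 0 := poch_ne_zero fun i hi e =>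
    (hgz (i + 1 - b) (by omega)).1 (by push_cast; linarith)
  refine ContinuousAt.mul (ContinuousAt.mul (ContinuousAt.div ?_ ?_ ?_) continuousAt_const)
    (tendsto_finsetSum _ fun k hk => ?_)
  · exact continuousAt_poch (by fun_prop) _
  · exact continuousAt_poch (by fun_prop) _
  · exact (poch_pos hg _).ne'
  have hk' : k ≤ a := by simpa [Nat.lt_succ_iff] using hk
  have q4 : poch (1 + g + b) k ≠ 0 := (poch_pos (by positivity) _).ne'
  have q5 : poch (1 - g - a) k ≠ 0 := poch_ne_zero fun i hi e => by
    have : (i : ℝ) + 1 ≤ a := by exact_mod_cast (by omega : i + 1 ≤ a)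
    linarith
  have q6 : poch (2 * g + b - m) k ≠ 0 := poch_ne_zero fun i hi e =>
    (hgz (m - b - i) (by omega)).2 (by push_cast; linarith)
  have q7 : poch (2 * g) n ≠ 0 := (poch_pos (by positivity) _).ne'
  have q8 : (m.factorial : ℝ) ≠ 0 := by positivity
  have q9 : (n.factorial : ℝ) ≠ 0 := by positivity
  have q10 : (k.factorial : ℝ) ≠ 0 := by positivity
  have hp : ∀ (f : ℝ → ℝ) (j : ℕ), Continuous f → ContinuousAt (fun t => poch (f t) j) g :=
    fun f j hf => continuousAt_poch hf.continuousAt j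
  have hc : ∀ c : ℝ, ContinuousAt (fun _ : ℝ => c) g := fun c => continuousAt_const
  exact ((((((hp _ _ (by fun_prop)).mul (hp _ _ (by fun_prop))).mul (hp _ _ (by fun_prop))).mul
    ((hp _ _ (by fun_prop)).div ((((hp _ _ (by fun_prop)).mul (hp _ _ (by fun_prop))).mul
      (hc _)).mul (hp _ _ (by fun_prop)))
      (mul_ne_zero (mul_ne_zero (mul_ne_zero q2 q3) q8) q6))).mul
    ((hc _).div ((hp _ _ (by fun_prop)).mul (hc _)) (mul_ne_zero q7 q9))).mul
    ((((hp _ _ (by fun_prop)).mul (hp _ _ (by fun_prop))).mul (hp _ _ (by fun_prop))).div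
      (((hp _ _ (by fun_prop)).mul (hp _ _ (by fun_prop))).mul (hc _))
      (mul_ne_zero (mul_ne_zero q4 q5) q10)))

end Coefficients

/-! ### Solving the triangular eigenvalue problem in elementary symmetric polynomials. -/

section ElementaryCoefficients

/-- The exponent of `e₁` in the term of index `(p, q)` of the expansion of a Jack polynomial in
products of elementary symmetric polynomials. -/
def expA (α p q : ℝ) : ℝ := α + q - 2 * p

/-- The exponent of `e₂` in the term of index `(p, q)`. -/
def expB (β p q : ℝ) : ℝ := β + p - 2 * q

/-- The difference between the eigenvalue of a Jack polynomial and the diagonal entry of `H_g` at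
the term of index `(p, q)`. -/
def eigenGap (α β g p q : ℝ) : ℝ :=
  p * (α + expA α p q) + q * (β + expB β p q) + 2 * g * (p + q)

/-- The coefficient of index `(p, q)` in terms of those of index `(p - 1, q)`, `(p - 1, q - 1)`
and `(p, q - 1)`. -/
noncomputable def jackStep (α β : ℕ) (g : ℝ) (p q : ℕ) (x y z : ℝ) : ℝ :=
  if 2 * p ≤ α + q ∧ 2 * q ≤ β + p then
    -(2 * (expA α p q + 2) * (expA α p q + 1) * x + 6 * (expA α p q + 1) * (expB β p q + 1) * y +
      2 * (expB β p q + 2) * (expB β p q + 1) * z) / eigenGap α β g p q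
  else 0

/-- The coefficient of `e₁ ^ (α + q - 2p) e₂ ^ (β + p - 2q) e₃ ^ (l₃ + q)` in the Jack polynomial of
a partition with `l₁₂ = α` and `l₂₃ = β`. -/
noncomputable def jackCoeff (α β : ℕ) (g : ℝ) : ℕ → ℕ → ℝ
  | 0, 0 => 1
  | p + 1, 0 => jackStep α β g (p + 1) 0 (jackCoeff α β g p 0) 0 0
  | 0, q + 1 => jackStep α β g 0 (q + 1) 0 0 (jackCoeff α β g 0 q)
  | p + 1, q + 1 => jackStep α β g (p + 1) (q + 1) (jackCoeff α β g p (q + 1))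
      (jackCoeff α β g p q) (jackCoeff α β g (p + 1) q)
  termination_by p q => (p, q)

variable {α β : ℕ} {g : ℝ}

/-- The excluded indices are those where an exponent of `e₁` or `e₂` would be negative. This makes
the truncated subtraction in the exponents harmless and the array finite. -/
theorem jackCoeff_eq_zero {p q : ℕ} (h : ¬(2 * p ≤ α + q ∧ 2 * q ≤ β + p)) :
    jackCoeff α β g p q = 0 := by
  rcases p with _ | p <;> rcases q with _ | q
  · omega
  all_goals rw [jackCoeff, jackStep, if_neg h]

theorem eigenGap_pos (hg : 0 < g) {p q : ℕ} (h : 2 * p ≤ α + q ∧ 2 * q ≤ β + p)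
    (hpq : 0 < p + q) : 0 < eigenGap α β g p q := by
  have h1 : (2 * p : ℝ) ≤ α + q := by exact_mod_cast h.1
  have h2 : (2 * q : ℝ) ≤ β + p := by exact_mod_cast h.2
  have h3 : (0 : ℝ) < p + q := by exact_mod_cast hpq
  have h4 : 0 ≤ expA α p q := by unfold expA; linarith
  have h5 : 0 ≤ expB β p q := by unfold expB; linarith
  unfold eigenGap
  positivity

theorem continuousAt_jackStep (hg : 0 < g) {p q : ℕ} (hpq : 0 < p + q) {x y z : ℝ → ℝ}
    (hx : ContinuousAt x g) (hy : ContinuousAt y g) (hz : ContinuousAt z g) :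
    ContinuousAt (fun t => jackStep α β t p q (x t) (y t) (z t)) g := by
  unfold jackStep
  split_ifs with h
  · refine ContinuousAt.div (by fun_prop) ?_ (eigenGap_pos hg h hpq).ne'
    unfold eigenGap
    fun_prop
  · exact continuousAt_const

theorem continuousAt_jackCoeff (hg : 0 < g) (p q : ℕ) :
    ContinuousAt (fun t => jackCoeff α β t p q) g := by
  induction p generalizing q with
  | zero =>
    induction q with
    | zero => simp only [jackCoeff]; exact continuousAt_const
    | succ q ih =>
      simp only [jackCoeff]
      exact continuousAt_jackStep hg (by omega) continuousAt_const continuousAt_const ih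
  | succ p ihp =>
    induction q with
    | zero =>
      simp only [jackCoeff]
      exact continuousAt_jackStep hg (by omega) (ihp 0) continuousAt_const continuousAt_const
    | succ q ih =>
      simp only [jackCoeff]
      exact continuousAt_jackStep hg (by omega) (ihp _) (ihp _) ih

/-- The function `f` moved by one step, with value `0` at `0`. -/
def shiftSeq {M : Type*} [Zero M] (f : ℕ → M) : ℕ → M
  | 0 => 0
  | n + 1 => f n

theorem sum_range_shiftSeq {M : Type*} [AddCommMonoid M] (f : ℕ → M) {K : ℕ}
    (h : ∀ n, n + 1 = K → f n = 0) :
    ∑ n ∈ Finset.range K, f n = ∑ n ∈ Finset.range K, shiftSeq f n := by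
  rcases K with _ | K
  · rfl
  · rw [Finset.sum_range_succ, h K rfl, Finset.sum_range_succ']
    simp [shiftSeq]

/-- At indices with nonnegative exponents this is the definition of `jackCoeff`, solvable because
the gap is positive. At the others the coefficient is zero and the point is that nothing flows in
from valid neighbours. -/
theorem jackCoeff_recurrence (hg : 0 < g) (p q : ℕ) :
    -eigenGap α β g p q * jackCoeff α β g p q -
      shiftSeq (fun p' => 2 * expA α p' q * (expA α p' q - 1) * jackCoeff α β g p' q) p -
      shiftSeq (fun p' => shiftSeq (fun q' => 6 * expA α p' q' * expB β p' q' *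
        jackCoeff α β g p' q') q) p -
      shiftSeq (fun q' => 2 * expB β p q' * (expB β p q' - 1) * jackCoeff α β g p q') q = 0 := by
  have hx : shiftSeq (fun p' => 2 * expA α p' q * (expA α p' q - 1) * jackCoeff α β g p' q) p =
      2 * (expA α p q + 2) * (expA α p q + 1) * shiftSeq (fun p' => jackCoeff α β g p' q) p := by
    rcases p with _ | p
    · simp [shiftSeq]
    · simp only [shiftSeq, expA]; push_cast; ring
  have hy : shiftSeq (fun p' => shiftSeq (fun q' => 6 * expA α p' q' * expB β p' q' *
        jackCoeff α β g p' q') q) p = 6 * (expA α p q + 1) * (expB β p q + 1) *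
        shiftSeq (fun p' => shiftSeq (fun q' => jackCoeff α β g p' q') q) p := by
    rcases p with _ | p
    · simp [shiftSeq]
    rcases q with _ | q
    · simp [shiftSeq]
    · simp only [shiftSeq, expA, expB]; push_cast; ring
  have hz : shiftSeq (fun q' => 2 * expB β p q' * (expB β p q' - 1) * jackCoeff α β g p q') q =
      2 * (expB β p q + 2) * (expB β p q + 1) * shiftSeq (fun q' => jackCoeff α β g p q') q := by
    rcases q with _ | q
    · simp [shiftSeq]
    · simp only [shiftSeq, expB]; push_cast; ring
  rw [hx, hy, hz]
  by_cases hv : 2 * p ≤ α + q ∧ 2 * q ≤ β + p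
  · have hr : 0 < p + q → jackCoeff α β g p q = jackStep α β g p q
        (shiftSeq (fun p' => jackCoeff α β g p' q) p)
        (shiftSeq (fun p' => shiftSeq (fun q' => jackCoeff α β g p' q') q) p)
        (shiftSeq (fun q' => jackCoeff α β g p q') q) := by
      intro h
      rcases p with _ | p <;> rcases q with _ | q
      · omega
      all_goals rw [jackCoeff]; rfl
    rcases Nat.eq_zero_or_pos (p + q) with h | h
    · obtain ⟨rfl, rfl⟩ : p = 0 ∧ q = 0 := by omega
      simp [shiftSeq, eigenGap]
    · rw [hr h, jackStep, if_pos hv]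
      have := (eigenGap_pos hg hv h).ne'
      field_simp
      ring
  · rw [jackCoeff_eq_zero hv]
    -- If the predecessor is valid but `(p, q)` is not, its exponent of `e₁` is 0 or 1, and the
    -- second-derivative factor $A(A-1)$ vanishes. The mixed term `ey` needs an exponent 0 in one of
    -- the two variables, and `ez` is the mirror image of `ex`.
    have ex : (expA α p q + 2) * (expA α p q + 1) *
        shiftSeq (fun p' => jackCoeff α β g p' q) p = 0 := by
      rcases p with _ | p
      · simp [shiftSeq]
      by_cases hv' : 2 * p ≤ α + q ∧ 2 * q ≤ β + p
      · have : α + q = 2 * p ∨ α + q = 2 * p + 1 := by omega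
        rcases this with h | h
        · have h' : (α : ℝ) + q = 2 * p := by exact_mod_cast h
          simp only [expA]; push_cast; rw [h']; ring
        · have h' : (α : ℝ) + q = 2 * p + 1 := by exact_mod_cast h
          simp only [expA]; push_cast; rw [h']; ring
      · simp [shiftSeq, jackCoeff_eq_zero hv']
    have ey : (expA α p q + 1) * (expB β p q + 1) *
        shiftSeq (fun p' => shiftSeq (fun q' => jackCoeff α β g p' q') q) p = 0 := by
      rcases p with _ | p
      · simp [shiftSeq]
      rcases q with _ | q
      · simp [shiftSeq]
      by_cases hv' : 2 * p ≤ α + q ∧ 2 * q ≤ β + p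
      · have : α + q = 2 * p ∨ β + p = 2 * q := by omega
        rcases this with h | h
        · have h' : (α : ℝ) + q = 2 * p := by exact_mod_cast h
          have : expA α (p + 1 : ℕ) (q + 1 : ℕ) + 1 = 0 := by
            simp only [expA]; push_cast; linear_combination h'
          rw [this]; ring
        · have h' : (β : ℝ) + p = 2 * q := by exact_mod_cast h
          have : expB β (p + 1 : ℕ) (q + 1 : ℕ) + 1 = 0 := by
            simp only [expB]; push_cast; linear_combination h'
          rw [this]; ring
      · simp [shiftSeq, jackCoeff_eq_zero hv']
    have ez : (expB β p q + 2) * (expB β p q + 1) *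
        shiftSeq (fun q' => jackCoeff α β g p q') q = 0 := by
      rcases q with _ | q
      · simp [shiftSeq]
      by_cases hv' : 2 * p ≤ α + q ∧ 2 * q ≤ β + p
      · have : β + p = 2 * q ∨ β + p = 2 * q + 1 := by omega
        rcases this with h | h
        · have h' : (β : ℝ) + p = 2 * q := by exact_mod_cast h
          simp only [expB]; push_cast; rw [h']; ring
        · have h' : (β : ℝ) + p = 2 * q + 1 := by exact_mod_cast h
          simp only [expB]; push_cast; rw [h']; ring
      · simp [shiftSeq, jackCoeff_eq_zero hv']
    linear_combination -2 * ex - 6 * ey - 2 * ez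

theorem shiftSeq_smul {M : Type*} [AddCommGroup M] [Module ℝ M] (f : ℕ → ℝ) (φ : ℕ → M) (n : ℕ) :
    shiftSeq (fun n => f n • φ (n + 1)) n = shiftSeq f n • φ n := by
  cases n <;> simp [shiftSeq]

/-- The combination with coefficients `jackCoeff` is an eigenvector of every operator that acts on
the vectors `φ p q` as `H_g` acts on the products of elementary symmetric polynomials. -/
theorem sum_jackCoeff_smul {M : Type*} [AddCommGroup M] [Module ℝ M] (hg : 0 < g) (φ : ℕ → ℕ → M)
    {K : ℕ} (hK : α + β + 1 < K) :
    ∑ p ∈ Finset.range K, ∑ q ∈ Finset.range K, jackCoeff α β g p q •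
      (-eigenGap α β g p q • φ p q - (2 * expA α p q * (expA α p q - 1)) • φ (p + 1) q -
        (6 * expA α p q * expB β p q) • φ (p + 1) (q + 1) -
        (2 * expB β p q * (expB β p q - 1)) • φ p (q + 1)) = 0 := by
  -- Valid indices satisfy $3p\le2\alpha+\beta$ and $3q\le\alpha+2\beta$, so reindexing by one step
  -- loses nothing at the upper end of the range.
  have hz : ∀ p q, p + 1 = K ∨ q + 1 = K → jackCoeff α β g p q = 0 := fun p q h =>
    jackCoeff_eq_zero (by omega)
  have e1 : ∑ p ∈ Finset.range K, ∑ q ∈ Finset.range K, jackCoeff α β g p q •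
      (2 * expA α p q * (expA α p q - 1)) • φ (p + 1) q =
      ∑ p ∈ Finset.range K, ∑ q ∈ Finset.range K, shiftSeq (fun p' => 2 * expA α p' q *
        (expA α p' q - 1) * jackCoeff α β g p' q) p • φ p q := by
    rw [Finset.sum_comm, Finset.sum_comm (s := Finset.range K) (t := Finset.range K)
      (f := fun p q => shiftSeq _ p • φ p q)]
    refine Finset.sum_congr rfl fun q _ => ?_
    rw [sum_range_shiftSeq _ fun p hp => by rw [hz p q (.inl hp), zero_smul]]
    refine Finset.sum_congr rfl fun p _ => ?_
    rw [← shiftSeq_smul _ fun p => φ p q]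
    congr 1; ext1 p; rw [smul_smul, mul_comm]
  have e2 : ∑ p ∈ Finset.range K, ∑ q ∈ Finset.range K, jackCoeff α β g p q •
      (6 * expA α p q * expB β p q) • φ (p + 1) (q + 1) =
      ∑ p ∈ Finset.range K, ∑ q ∈ Finset.range K, shiftSeq (fun p' => shiftSeq (fun q' =>
        6 * expA α p' q' * expB β p' q' * jackCoeff α β g p' q') q) p • φ p q := by
    have : ∀ p, ∑ q ∈ Finset.range K, jackCoeff α β g p q •
        (6 * expA α p q * expB β p q) • φ (p + 1) (q + 1) =
        ∑ q ∈ Finset.range K, shiftSeq (fun q' =>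
          6 * expA α p q' * expB β p q' * jackCoeff α β g p q') q • φ (p + 1) q := by
      intro p
      rw [sum_range_shiftSeq _ fun q hq => by rw [hz p q (.inr hq), zero_smul]]
      refine Finset.sum_congr rfl fun q _ => ?_
      rw [← shiftSeq_smul _ fun q => φ (p + 1) q]
      congr 1; ext1 q; rw [smul_smul, mul_comm]
    simp only [this]
    rw [Finset.sum_comm, Finset.sum_comm (s := Finset.range K) (t := Finset.range K)
      (f := fun p q => shiftSeq _ p • φ p q)]
    refine Finset.sum_congr rfl fun q _ => ?_
    rw [sum_range_shiftSeq _ fun p hp => ?_]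
    · exact Finset.sum_congr rfl fun p _ => shiftSeq_smul _ (fun p => φ p q) p
    · have : shiftSeq (fun q' => 6 * expA α p q' * expB β p q' * jackCoeff α β g p q') q = 0 := by
        cases q
        · rfl
        · simp [shiftSeq, hz p _ (.inl hp)]
      rw [this, zero_smul]
  have e3 : ∑ p ∈ Finset.range K, ∑ q ∈ Finset.range K, jackCoeff α β g p q •
      (2 * expB β p q * (expB β p q - 1)) • φ p (q + 1) =
      ∑ p ∈ Finset.range K, ∑ q ∈ Finset.range K, shiftSeq (fun q' => 2 * expB β p q' *
        (expB β p q' - 1) * jackCoeff α β g p q') q • φ p q := by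
    refine Finset.sum_congr rfl fun p _ => ?_
    rw [sum_range_shiftSeq _ fun q hq => by rw [hz p q (.inr hq), zero_smul]]
    refine Finset.sum_congr rfl fun q _ => ?_
    rw [← shiftSeq_smul _ fun q => φ p q]
    congr 1; ext1 q; rw [smul_smul, mul_comm]
  simp only [smul_sub, Finset.sum_sub_distrib]
  rw [e1, e2, e3]
  simp only [← Finset.sum_sub_distrib]
  refine Finset.sum_eq_zero fun p _ => Finset.sum_eq_zero fun q _ => ?_
  rw [smul_smul, ← sub_smul, ← sub_smul, ← sub_smul, mul_comm (jackCoeff α β g p q),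
    jackCoeff_recurrence hg p q, zero_smul]

end ElementaryCoefficients

/-! ### Second-order chain rule for monomials in three elements of a ring. -/

section Derivations

variable {R : Type*} [CommRing R]

/-- The first derivative of the `n`-th power. -/
def powDeriv (f : R) (n : ℕ) : R := n * f ^ (n - 1)

/-- The second derivative of the `n`-th power. -/
def powDeriv₂ (f : R) (n : ℕ) : R := n * (n - 1) * f ^ (n - 2)

theorem mul_powDeriv (f : R) (n : ℕ) : f * powDeriv f n = n * f ^ n := by
  rcases n with _ | n
  · simp [powDeriv]
  · simp only [powDeriv, Nat.add_sub_cancel]; ring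

theorem mul_powDeriv₂ (f : R) (n : ℕ) : f * powDeriv₂ f n = (n - 1) * powDeriv f n := by
  rcases n with _ | _ | n
  · simp [powDeriv, powDeriv₂]
  · simp [powDeriv, powDeriv₂]
  · simp only [powDeriv, powDeriv₂, Nat.add_sub_cancel, show n + 1 + 1 - 2 = n by omega]; ring

/-- `H_g` in terms of elementary symmetric polynomials, applied to a monomial in them. -/
theorem elementary_operator_monomial (γ s₁ s₂ s₃ : R) (a b c : ℕ) :
    (s₁ ^ 2 - 2 * s₂) * (powDeriv₂ s₁ a * s₂ ^ b * s₃ ^ c) +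
      (2 * s₂ ^ 2 - 2 * s₁ * s₃) * (s₁ ^ a * powDeriv₂ s₂ b * s₃ ^ c) +
      3 * s₃ ^ 2 * (s₁ ^ a * s₂ ^ b * powDeriv₂ s₃ c) +
      2 * (s₁ * s₂ - 3 * s₃) * (powDeriv s₁ a * powDeriv s₂ b * s₃ ^ c) +
      2 * s₁ * s₃ * (powDeriv s₁ a * s₂ ^ b * powDeriv s₃ c) +
      4 * s₂ * s₃ * (s₁ ^ a * powDeriv s₂ b * powDeriv s₃ c) +
      (1 + 2 * γ) * s₁ * (powDeriv s₁ a * s₂ ^ b * s₃ ^ c) +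
      (2 + 2 * γ) * s₂ * (s₁ ^ a * powDeriv s₂ b * s₃ ^ c) +
      3 * s₃ * (s₁ ^ a * s₂ ^ b * powDeriv s₃ c) =
    ((a + b + c) ^ 2 + (b + c) ^ 2 + c ^ 2 + 2 * γ * (a + b)) * (s₁ ^ a * s₂ ^ b * s₃ ^ c) -
      2 * a * (a - 1) * (s₁ ^ (a - 2) * s₂ ^ (b + 1) * s₃ ^ c) -
      6 * a * b * (s₁ ^ (a - 1) * s₂ ^ (b - 1) * s₃ ^ (c + 1)) -
      2 * b * (b - 1) * (s₁ ^ (a + 1) * s₂ ^ (b - 2) * s₃ ^ (c + 1)) := by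
  have a1 := mul_powDeriv s₁ a
  have a2 := mul_powDeriv₂ s₁ a
  have b1 := mul_powDeriv s₂ b
  have b2 := mul_powDeriv₂ s₂ b
  have c1 := mul_powDeriv s₃ c
  have c2 := mul_powDeriv₂ s₃ c
  have e1 : 2 * (a : R) * (a - 1) * (s₁ ^ (a - 2) * s₂ ^ (b + 1) * s₃ ^ c) =
      2 * s₂ * (powDeriv₂ s₁ a * s₂ ^ b * s₃ ^ c) := by
    rw [powDeriv₂, pow_succ]; ring
  have e2 : 6 * (a : R) * b * (s₁ ^ (a - 1) * s₂ ^ (b - 1) * s₃ ^ (c + 1)) =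
      6 * s₃ * (powDeriv s₁ a * powDeriv s₂ b * s₃ ^ c) := by
    rw [powDeriv, powDeriv, pow_succ]; ring
  have e3 : 2 * (b : R) * (b - 1) * (s₁ ^ (a + 1) * s₂ ^ (b - 2) * s₃ ^ (c + 1)) =
      2 * s₁ * s₃ * (s₁ ^ a * powDeriv₂ s₂ b * s₃ ^ c) := by
    rw [powDeriv₂, pow_succ, pow_succ]; ring
  rw [e1, e2, e3]
  have a3 : s₁ ^ 2 * powDeriv₂ s₁ a = a * (a - 1) * s₁ ^ a := by
    linear_combination s₁ * a2 + (a - 1 : R) * a1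
  have b3 : s₂ ^ 2 * powDeriv₂ s₂ b = b * (b - 1) * s₂ ^ b := by
    linear_combination s₂ * b2 + (b - 1 : R) * b1
  have c3 : s₃ ^ 2 * powDeriv₂ s₃ c = c * (c - 1) * s₃ ^ c := by
    linear_combination s₃ * c2 + (c - 1 : R) * c1
  generalize powDeriv₂ s₁ a = A2 at *
  generalize powDeriv₂ s₂ b = B2 at *
  generalize powDeriv₂ s₃ c = C2 at *
  generalize powDeriv s₁ a = A1 at *
  generalize powDeriv s₂ b = B1 at *
  generalize powDeriv s₃ c = C1 at *
  generalize s₁ ^ a = A0 at *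
  generalize s₂ ^ b = B0 at *
  generalize s₃ ^ c = C0 at *
  linear_combination B0 * C0 * a3 + 2 * A0 * C0 * b3 + 3 * A0 * B0 * c3 +
    2 * s₂ * B1 * C0 * a1 + 2 * a * A0 * C0 * b1 + 2 * s₃ * B0 * C1 * a1 + 2 * a * A0 * B0 * c1 +
    4 * s₃ * A0 * C1 * b1 + 4 * b * A0 * B0 * c1 + (1 + 2 * γ) * B0 * C0 * a1 +
    (2 + 2 * γ) * A0 * C0 * b1 + 3 * A0 * B0 * c1

variable [Algebra ℝ R]

theorem derivation_pow (D : Derivation ℝ R R) (f : R) (n : ℕ) :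
    D (f ^ n) = powDeriv f n * D f := by
  rw [Derivation.leibniz_pow, nsmul_eq_mul, smul_eq_mul, powDeriv, mul_assoc]

theorem derivation_powDeriv (D : Derivation ℝ R R) (f : R) (n : ℕ) :
    D (powDeriv f n) = powDeriv₂ f n * D f := by
  rcases n with _ | n
  · simp [powDeriv, powDeriv₂]
  · simp only [powDeriv, powDeriv₂, Derivation.leibniz, Derivation.leibniz_pow,
      Derivation.map_natCast, Nat.add_sub_cancel, show n + 1 - 2 = n - 1 by omega, smul_eq_mul,
      nsmul_eq_mul]
    push_cast; ring

theorem derivation_mul (D : Derivation ℝ R R) (f h : R) : D (f * h) = D f * h + f * D h := by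
  rw [Derivation.leibniz, smul_eq_mul, smul_eq_mul]; ring

theorem derivation_monomial (D : Derivation ℝ R R) (f₁ f₂ f₃ : R) (a b c : ℕ) :
    D (f₁ ^ a * f₂ ^ b * f₃ ^ c) = powDeriv f₁ a * f₂ ^ b * f₃ ^ c * D f₁ +
      f₁ ^ a * powDeriv f₂ b * f₃ ^ c * D f₂ + f₁ ^ a * f₂ ^ b * powDeriv f₃ c * D f₃ := by
  simp only [derivation_mul, derivation_pow]; ring

theorem derivation_derivation_monomial (D D' : Derivation ℝ R R) (f₁ f₂ f₃ : R) (a b c : ℕ) :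
    D' (D (f₁ ^ a * f₂ ^ b * f₃ ^ c)) =
      powDeriv₂ f₁ a * f₂ ^ b * f₃ ^ c * (D f₁ * D' f₁) +
      f₁ ^ a * powDeriv₂ f₂ b * f₃ ^ c * (D f₂ * D' f₂) +
      f₁ ^ a * f₂ ^ b * powDeriv₂ f₃ c * (D f₃ * D' f₃) +
      powDeriv f₁ a * powDeriv f₂ b * f₃ ^ c * (D f₁ * D' f₂ + D f₂ * D' f₁) +
      powDeriv f₁ a * f₂ ^ b * powDeriv f₃ c * (D f₁ * D' f₃ + D f₃ * D' f₁) +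
      f₁ ^ a * powDeriv f₂ b * powDeriv f₃ c * (D f₂ * D' f₃ + D f₃ * D' f₂) +
      powDeriv f₁ a * f₂ ^ b * f₃ ^ c * D' (D f₁) + f₁ ^ a * powDeriv f₂ b * f₃ ^ c * D' (D f₂) +
      f₁ ^ a * f₂ ^ b * powDeriv f₃ c * D' (D f₃) := by
  rw [derivation_monomial]
  simp only [map_add, derivation_mul, derivation_pow, derivation_powDeriv]; ring

end Derivations

/-! ### The action of $H_g$ on monomials in elementary symmetric polynomials. -/

section Elementary

open MvPolynomial

/-- The first elementary symmetric polynomial in three variables. -/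
noncomputable def e₁ : MvPolynomial (Fin 3) ℝ := X 0 + X 1 + X 2

/-- The second elementary symmetric polynomial in three variables. -/
noncomputable def e₂ : MvPolynomial (Fin 3) ℝ := X 0 * X 1 + X 0 * X 2 + X 1 * X 2

/-- The third elementary symmetric polynomial in three variables. -/
noncomputable def e₃ : MvPolynomial (Fin 3) ℝ := X 0 * X 1 * X 2

/-- The Euler operator as a derivation. -/
noncomputable def eulerDerivation {n : ℕ} (i : Fin n) :
    Derivation ℝ (MvPolynomial (Fin n) ℝ) (MvPolynomial (Fin n) ℝ) :=
  (X i : MvPolynomial (Fin n) ℝ) • pderiv i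

theorem euler_eq_eulerDerivation {n : ℕ} (i : Fin n) (P : MvPolynomial (Fin n) ℝ) :
    euler i P = eulerDerivation i P := rfl

theorem eulerDerivation_X {n : ℕ} (i j : Fin n) :
    eulerDerivation i (X j) = if i = j then X i else 0 := by
  by_cases h : i = j
  · subst h; simp [eulerDerivation]
  · simp [eulerDerivation, h, pderiv_X_of_ne (Ne.symm h)]

theorem eulerDerivation_e₁ (i : Fin 3) : eulerDerivation i e₁ = X i := by
  simp only [e₁, map_add, eulerDerivation_X]
  fin_cases i <;> simp

theorem eulerDerivation_e₂ (i : Fin 3) : eulerDerivation i e₂ = X i * (e₁ - X i) := by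
  simp only [e₁, e₂, map_add, derivation_mul, eulerDerivation_X]
  fin_cases i <;> simp <;> ring

theorem eulerDerivation_e₃ (i : Fin 3) : eulerDerivation i e₃ = e₃ := by
  simp only [e₃, derivation_mul, eulerDerivation_X]
  fin_cases i <;> simp

theorem eval_euler_monomial (i : Fin 3) (x : Fin 3 → ℝ) (a b c : ℕ) :
    eval x (euler i (e₁ ^ a * e₂ ^ b * e₃ ^ c)) =
      x i * (powDeriv (eval x e₁) a * eval x e₂ ^ b * eval x e₃ ^ c) +
      x i * (eval x e₁ - x i) * (eval x e₁ ^ a * powDeriv (eval x e₂) b * eval x e₃ ^ c) +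
      eval x e₃ * (eval x e₁ ^ a * eval x e₂ ^ b * powDeriv (eval x e₃) c) := by
  rw [euler_eq_eulerDerivation, derivation_monomial, eulerDerivation_e₁, eulerDerivation_e₂,
    eulerDerivation_e₃]
  simp only [powDeriv, map_add, map_mul, map_sub, map_pow, map_natCast, eval_X]
  ring

theorem eval_euler_euler_monomial (i : Fin 3) (x : Fin 3 → ℝ) (a b c : ℕ) :
    eval x (euler i (euler i (e₁ ^ a * e₂ ^ b * e₃ ^ c))) =
      x i ^ 2 * (powDeriv₂ (eval x e₁) a * eval x e₂ ^ b * eval x e₃ ^ c) +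
      (x i * (eval x e₁ - x i)) ^ 2 *
        (eval x e₁ ^ a * powDeriv₂ (eval x e₂) b * eval x e₃ ^ c) +
      eval x e₃ ^ 2 * (eval x e₁ ^ a * eval x e₂ ^ b * powDeriv₂ (eval x e₃) c) +
      2 * x i * (x i * (eval x e₁ - x i)) *
        (powDeriv (eval x e₁) a * powDeriv (eval x e₂) b * eval x e₃ ^ c) +
      2 * x i * eval x e₃ * (powDeriv (eval x e₁) a * eval x e₂ ^ b * powDeriv (eval x e₃) c) +
      2 * (x i * (eval x e₁ - x i)) * eval x e₃ *
        (eval x e₁ ^ a * powDeriv (eval x e₂) b * powDeriv (eval x e₃) c) +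
      x i * (powDeriv (eval x e₁) a * eval x e₂ ^ b * eval x e₃ ^ c) +
      x i * (eval x e₁ - x i) * (eval x e₁ ^ a * powDeriv (eval x e₂) b * eval x e₃ ^ c) +
      eval x e₃ * (eval x e₁ ^ a * eval x e₂ ^ b * powDeriv (eval x e₃) c) := by
  rw [euler_eq_eulerDerivation, euler_eq_eulerDerivation, derivation_derivation_monomial,
    eulerDerivation_e₁, eulerDerivation_e₂, eulerDerivation_e₃, derivation_mul, map_sub,
    eulerDerivation_e₁, eulerDerivation_X, eulerDerivation_e₃]
  simp only [powDeriv, powDeriv₂, map_add, map_mul, map_sub, map_pow, map_natCast, eval_X, map_one,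
    if_true]
  ring

theorem hamiltonianAt_three (g : ℝ) (P : MvPolynomial (Fin 3) ℝ) (x : Fin 3 → ℝ) :
    hamiltonianAt g P x = eval x (euler 0 (euler 0 P)) + eval x (euler 1 (euler 1 P)) +
      eval x (euler 2 (euler 2 P)) + g *
      ((x 0 + x 1) / (x 0 - x 1) * (eval x (euler 0 P) - eval x (euler 1 P)) +
       (x 0 + x 2) / (x 0 - x 2) * (eval x (euler 0 P) - eval x (euler 2 P)) +
       (x 1 + x 2) / (x 1 - x 2) * (eval x (euler 1 P) - eval x (euler 2 P))) := by
  have h0 : Finset.Ioi (0 : Fin 3) = {1, 2} := by decide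
  have h1 : Finset.Ioi (1 : Fin 3) = {2} := by decide
  have h2 : Finset.Ioi (2 : Fin 3) = ∅ := by decide
  simp [hamiltonianAt, Fin.sum_univ_three, h0, h1, h2]

theorem hamiltonianAt_monomial (g : ℝ) {x : Fin 3 → ℝ} (hx : Function.Injective x) (a b c : ℕ) :
    hamiltonianAt g (e₁ ^ a * e₂ ^ b * e₃ ^ c) x =
      ((a + b + c) ^ 2 + (b + c) ^ 2 + c ^ 2 + 2 * g * (a + b)) *
        eval x (e₁ ^ a * e₂ ^ b * e₃ ^ c) -
      2 * a * (a - 1) * eval x (e₁ ^ (a - 2) * e₂ ^ (b + 1) * e₃ ^ c) -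
      6 * a * b * eval x (e₁ ^ (a - 1) * e₂ ^ (b - 1) * e₃ ^ (c + 1)) -
      2 * b * (b - 1) * eval x (e₁ ^ (a + 1) * e₂ ^ (b - 2) * e₃ ^ (c + 1)) := by
  have h01 : x 0 - x 1 ≠ 0 := sub_ne_zero.2 (hx.ne (by decide))
  have h02 : x 0 - x 2 ≠ 0 := sub_ne_zero.2 (hx.ne (by decide))
  have h12 : x 1 - x 2 ≠ 0 := sub_ne_zero.2 (hx.ne (by decide))
  simp only [map_mul, map_pow]
  rw [← elementary_operator_monomial, hamiltonianAt_three]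
  simp only [eval_euler_euler_monomial]
  -- The difference of the Euler operators sends `e₁`, `e₂`, `e₃` to $x_i-x_j$,
  -- $(x_i-x_j)(e_1-x_i-x_j)$ and $0$, so the denominator always cancels.
  have hdiff : ∀ i j : Fin 3, x i - x j ≠ 0 → (x i + x j) / (x i - x j) *
      (eval x (euler i (e₁ ^ a * e₂ ^ b * e₃ ^ c)) -
        eval x (euler j (e₁ ^ a * e₂ ^ b * e₃ ^ c))) =
      (x i + x j) * (powDeriv (eval x e₁) a * eval x e₂ ^ b * eval x e₃ ^ c +
        (eval x e₁ - x i - x j) *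
          (eval x e₁ ^ a * powDeriv (eval x e₂) b * eval x e₃ ^ c)) := by
    intro i j hij
    rw [eval_euler_monomial, eval_euler_monomial]
    field_simp
    ring
  rw [hdiff 0 1 h01, hdiff 0 2 h02, hdiff 1 2 h12]
  have s1 : eval x e₁ = x 0 + x 1 + x 2 := by simp [e₁]
  have s2 : eval x e₂ = x 0 * x 1 + x 0 * x 2 + x 1 * x 2 := by simp [e₂]
  have s3 : eval x e₃ = x 0 * x 1 * x 2 := by simp [e₃]
  generalize powDeriv₂ (eval x e₁) a = A2 at *
  generalize powDeriv₂ (eval x e₂) b = B2 at *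
  generalize powDeriv₂ (eval x e₃) c = C2 at *
  generalize powDeriv (eval x e₁) a = A1 at *
  generalize powDeriv (eval x e₂) b = B1 at *
  generalize powDeriv (eval x e₃) c = C1 at *
  generalize eval x e₁ ^ a = A0 at *
  generalize eval x e₂ ^ b = B0 at *
  generalize eval x e₃ ^ c = C0 at *
  rw [s1, s2, s3]
  ring

end Elementary

end Jack

namespace Jack

open MvPolynomial

/-! ### Leading terms in the dominance order. -/

section LeadingTerm

theorem dominated_iff (m l : Fin 3 → ℕ) : Dominated m l ↔
    m 0 + m 1 + m 2 = l 0 + l 1 + l 2 ∧ m 0 ≤ l 0 ∧ m 0 + m 1 ≤ l 0 + l 1 := by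
  have h0 : Finset.Iic (0 : Fin 3) = {0} := by decide
  have h1 : Finset.Iic (1 : Fin 3) = {0, 1} := by decide
  have h2 : Finset.Iic (2 : Fin 3) = {0, 1, 2} := by decide
  simp only [Dominated, Fin.sum_univ_three, Fin.forall_fin_succ]
  simp [h0, h1, h2]
  omega

/-- `P` has the leading term `x ^ l` in the dominance order, with coefficient `1`. -/
structure HasLeadingTerm (P : MvPolynomial (Fin 3) ℝ) (l : Fin 3 → ℕ) : Prop where
  coeff_eq_one : P.coeff (Finsupp.equivFunOnFinite.symm l) = 1
  dominated : ∀ ν : Fin 3 →₀ ℕ, P.coeff ν ≠ 0 → Dominated ν l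

theorem HasLeadingTerm.one : HasLeadingTerm 1 0 where
  coeff_eq_one := by
    have : Finsupp.equivFunOnFinite.symm (0 : Fin 3 → ℕ) = 0 := by ext; simp
    rw [this]; simp
  dominated ν h := by
    have : ν = 0 := by
      by_contra h'
      exact h (by rw [coeff_one, if_neg (Ne.symm h')])
    subst this
    simp [dominated_iff]

/-- Dominance is additive, and if `y ≤ l`, `z ≤ m` add up to `l + m` then all the partial-sum
inequalities are equalities. Hence only one pair of exponents contributes to the leading
coefficient. -/
theorem HasLeadingTerm.mul {P Q : MvPolynomial (Fin 3) ℝ} {l m : Fin 3 → ℕ}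
    (hP : HasLeadingTerm P l) (hQ : HasLeadingTerm Q m) : HasLeadingTerm (P * Q) (l + m) where
  coeff_eq_one := by
    rw [coeff_mul, Finset.sum_eq_single (Finsupp.equivFunOnFinite.symm l,
      Finsupp.equivFunOnFinite.symm m), hP.coeff_eq_one, hQ.coeff_eq_one, one_mul]
    · rintro ⟨y, z⟩ hyz hne
      by_contra hc
      have h1 := (dominated_iff _ _).1 (hP.dominated y (left_ne_zero_of_mul hc))
      have h2 := (dominated_iff _ _).1 (hQ.dominated z (right_ne_zero_of_mul hc))
      have h3 : y + z = Finsupp.equivFunOnFinite.symm (l + m) := by simpa using hyz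
      have e : ∀ i, y i + z i = l i + m i := fun i => by
        have := DFunLike.congr_fun h3 i; simpa using this
      have e0 := e 0
      have e1 := e 1
      have e2 := e 2
      refine hne (Prod.ext ?_ ?_)
      · ext i; fin_cases i <;> simp <;> omega
      · ext i; fin_cases i <;> simp <;> omega
    · intro h
      refine absurd (Finset.HasAntidiagonal.mem_antidiagonal.2 ?_) h
      ext i; simp
  dominated ν h := by
    rw [coeff_mul] at h
    obtain ⟨⟨y, z⟩, hyz, hc⟩ := Finset.exists_ne_zero_of_sum_ne_zero h
    have h1 := (dominated_iff _ _).1 (hP.dominated y (left_ne_zero_of_mul hc))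
    have h2 := (dominated_iff _ _).1 (hQ.dominated z (right_ne_zero_of_mul hc))
    have h3 : y + z = ν := by simpa using hyz
    subst h3
    simp only [dominated_iff, Finsupp.add_apply, Pi.add_apply]
    omega

theorem HasLeadingTerm.pow {P : MvPolynomial (Fin 3) ℝ} {l : Fin 3 → ℕ}
    (hP : HasLeadingTerm P l) (n : ℕ) : HasLeadingTerm (P ^ n) (n • l) := by
  induction n with
  | zero => simpa using HasLeadingTerm.one
  | succ n ih => rw [pow_succ, succ_nsmul]; exact ih.mul hP

theorem hasLeadingTerm_add_add {x y z : Fin 3 →₀ ℕ} (hxy : x ≠ y) (hxz : x ≠ z)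
    (hy : Dominated y x) (hz : Dominated z x) :
    HasLeadingTerm (monomial x 1 + monomial y 1 + monomial z 1) x where
  coeff_eq_one := by
    have : Finsupp.equivFunOnFinite.symm (x : Fin 3 → ℕ) = x := by ext; simp
    rw [this]; simp [coeff_monomial, hxy.symm, hxz.symm]
  dominated ν h := by
    simp only [coeff_add, coeff_monomial] at h
    by_cases h1 : x = ν
    · subst h1; simp [dominated_iff]
    by_cases h2 : y = ν
    · subst h2; exact hy
    by_cases h3 : z = ν
    · subst h3; exact hz
    simp [h1, h2, h3] at h

theorem hasLeadingTerm_e₁ : HasLeadingTerm e₁ ![1, 0, 0] := by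
  have h : HasLeadingTerm e₁ _ := hasLeadingTerm_add_add (x := Finsupp.single 0 1)
    (y := Finsupp.single 1 1) (z := Finsupp.single 2 1)
    (fun h => by simpa using DFunLike.congr_fun h 0)
    (fun h => by simpa using DFunLike.congr_fun h 0) (by simp [dominated_iff])
    (by simp [dominated_iff])
  have e : ![1, 0, 0] = ⇑(Finsupp.single (0 : Fin 3) 1) := by
    ext i; fin_cases i <;> simp
  rwa [e]

theorem hasLeadingTerm_e₂ : HasLeadingTerm e₂ ![1, 1, 0] := by
  have h := hasLeadingTerm_add_add (x := Finsupp.single 0 1 + Finsupp.single 1 1)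
    (y := Finsupp.single 0 1 + Finsupp.single 2 1)
    (z := Finsupp.single 1 1 + Finsupp.single 2 1)
    (fun h => by simpa using DFunLike.congr_fun h 1)
    (fun h => by simpa using DFunLike.congr_fun h 0) (by simp [dominated_iff])
    (by simp [dominated_iff])
  have e : ![1, 1, 0] = ⇑(Finsupp.single 0 1 + Finsupp.single 1 1 : Fin 3 →₀ ℕ) := by
    ext i; fin_cases i <;> simp
  have e' : e₂ = monomial (Finsupp.single 0 1 + Finsupp.single 1 1) 1 +
      monomial (Finsupp.single 0 1 + Finsupp.single 2 1) 1 +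
      monomial (Finsupp.single 1 1 + Finsupp.single 2 1) 1 := by
    simp [e₂, X, monomial_mul]
  rwa [e, e']

theorem hasLeadingTerm_e₃ : HasLeadingTerm e₃ ![1, 1, 1] where
  coeff_eq_one := by
    have : Finsupp.equivFunOnFinite.symm ![1, 1, 1] =
        (Finsupp.single 0 1 + Finsupp.single 1 1 + Finsupp.single 2 1 : Fin 3 →₀ ℕ) := by
      ext i; fin_cases i <;> simp
    simp [e₃, X, monomial_mul, this]
  dominated ν h := by
    have : e₃ = monomial (Finsupp.single 0 1 + Finsupp.single 1 1 + Finsupp.single 2 1) 1 := by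
      simp [e₃, X, monomial_mul]
    rw [this, coeff_monomial] at h
    have h' : Finsupp.single 0 1 + Finsupp.single 1 1 + Finsupp.single 2 1 = ν := by
      by_contra h'; exact h (if_neg h')
    subst h'
    simp [dominated_iff]

theorem hasLeadingTerm_monomial (a b c : ℕ) :
    HasLeadingTerm (e₁ ^ a * e₂ ^ b * e₃ ^ c) ![a + b + c, b + c, c] := by
  convert ((hasLeadingTerm_e₁.pow a).mul (hasLeadingTerm_e₂.pow b)).mul (hasLeadingTerm_e₃.pow c)
    using 1
  ext i; fin_cases i <;> simp

end LeadingTerm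

/-! ### Existence of the Jack polynomial. -/

section Existence

theorem isSymmetric_e₁ : e₁.IsSymmetric := by
  have : e₁ = psum (Fin 3) ℝ 1 := by simp [e₁, psum, Fin.sum_univ_three]
  rw [this]; exact psum_isSymmetric _ _ _

theorem isSymmetric_e₃ : e₃.IsSymmetric := by
  intro σ
  have : e₃ = ∏ i : Fin 3, (X i : MvPolynomial (Fin 3) ℝ) := by simp [e₃, Fin.prod_univ_three]
  rw [this, map_prod]
  simp only [rename_X]
  exact Equiv.prod_comp σ fun i => (X i : MvPolynomial (Fin 3) ℝ)

theorem isSymmetric_pow {P : MvPolynomial (Fin 3) ℝ} (h : P.IsSymmetric) (n : ℕ) :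
    (P ^ n).IsSymmetric := fun σ => by rw [map_pow, h σ]

theorem isSymmetric_e₂ : e₂.IsSymmetric := by
  have h : (2 : ℝ) • e₂ = e₁ ^ 2 - psum (Fin 3) ℝ 2 := by
    rw [smul_eq_C_mul, map_ofNat]
    simp only [e₁, e₂, psum, Fin.sum_univ_three]; ring
  have h' : e₂ = (1 / 2 : ℝ) • (e₁ ^ 2 - psum (Fin 3) ℝ 2) := by
    rw [← h, smul_smul]; norm_num
  rw [h']
  exact ((isSymmetric_pow isSymmetric_e₁ 2).sub (psum_isSymmetric _ _ _)).smul _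

theorem isSymmetric_sum {ι : Type*} (s : Finset ι) (f : ι → MvPolynomial (Fin 3) ℝ)
    (h : ∀ i ∈ s, (f i).IsSymmetric) : (∑ i ∈ s, f i).IsSymmetric := fun σ => by
  rw [map_sum]; exact Finset.sum_congr rfl fun i hi => h i hi σ

/-- The eigenvalue in terms of the exponents of `e₁`, `e₂`, `e₃` in the leading term. -/
def elementaryEigenvalue (g α β ℓ : ℝ) : ℝ :=
  (α + β + ℓ) ^ 2 + (β + ℓ) ^ 2 + ℓ ^ 2 + 2 * g * (α + β)

/-- Here `G a b c` stands for a realisation of $e_1^ae_2^be_3^c$ and `F a b c` for $H_g-E$ applied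
to it. Keeping `M` abstract lets one computation serve both for evaluation at a real point and for
polynomials in $u,v$. The weight condition is needed in the latter case, where the operator depends
on the degree. -/
theorem sum_jackCoeff_operator {M : Type*} [AddCommGroup M] [Module ℝ M] {α β ℓ : ℕ} {g : ℝ}
    (hg : 0 < g) (F G : ℕ → ℕ → ℕ → M)
    (h : ∀ a b c : ℕ, a + 2 * b + 3 * c = α + 2 * β + 3 * ℓ → F a b c =
      (elementaryEigenvalue g a b c - elementaryEigenvalue g α β ℓ) • G a b c -
      (2 * a * (a - 1) : ℝ) • G (a - 2) (b + 1) c -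
      (6 * a * b : ℝ) • G (a - 1) (b - 1) (c + 1) -
      (2 * b * (b - 1) : ℝ) • G (a + 1) (b - 2) (c + 1)) :
    ∑ p ∈ Finset.range (α + β + 2), ∑ q ∈ Finset.range (α + β + 2),
      jackCoeff α β g p q • F (α + q - 2 * p) (β + p - 2 * q) (ℓ + q) = 0 := by
  rw [← sum_jackCoeff_smul (M := M) hg
    (fun p q => G (α + q - 2 * p) (β + p - 2 * q) (ℓ + q)) (Nat.lt_succ_self (α + β + 1))]
  refine Finset.sum_congr rfl fun p _ => Finset.sum_congr rfl fun q _ => ?_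
  by_cases hv : 2 * p ≤ α + q ∧ 2 * q ≤ β + p
  · rw [h _ _ _ (by omega)]
    have hA : ((α + q - 2 * p : ℕ) : ℝ) = expA α p q := by
      rw [Nat.cast_sub hv.1, expA]; push_cast; ring
    have hB : ((β + p - 2 * q : ℕ) : ℝ) = expB β p q := by
      rw [Nat.cast_sub hv.2, expB]; push_cast; ring
    have hE : elementaryEigenvalue g (expA α p q) (expB β p q) (ℓ + q : ℕ) -
        elementaryEigenvalue g α β ℓ = -eigenGap α β g p q := by
      unfold elementaryEigenvalue eigenGap expA expB
      push_cast
      ring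
    have i1 : α + q - 2 * (p + 1) = α + q - 2 * p - 2 := by omega
    have i2 : β + (p + 1) - 2 * q = β + p - 2 * q + 1 := by omega
    have i3 : α + (q + 1) - 2 * (p + 1) = α + q - 2 * p - 1 := by omega
    have i4 : β + (p + 1) - 2 * (q + 1) = β + p - 2 * q - 1 := by omega
    have i5 : α + (q + 1) - 2 * p = α + q - 2 * p + 1 := by omega
    have i6 : β + p - 2 * (q + 1) = β + p - 2 * q - 2 := by omega
    have i7 : ℓ + (q + 1) = ℓ + q + 1 := rfl
    rw [hA, hB, hE, i1, i2, i3, i4, i5, i6, i7]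
  · rw [jackCoeff_eq_zero hv, zero_smul, zero_smul]

/-- The Jack polynomial of the partition `(α + β + ℓ, β + ℓ, ℓ)`. -/
noncomputable def jackPoly (α β ℓ : ℕ) (g : ℝ) : MvPolynomial (Fin 3) ℝ :=
  ∑ p ∈ Finset.range (α + β + 2), ∑ q ∈ Finset.range (α + β + 2),
    jackCoeff α β g p q • (e₁ ^ (α + q - 2 * p) * e₂ ^ (β + p - 2 * q) * e₃ ^ (ℓ + q))

/-- The evaluation of `H_g P` at `x` as a linear map in `P`. -/
noncomputable def hamiltonianLinear (g : ℝ) (x : Fin 3 → ℝ) : MvPolynomial (Fin 3) ℝ →ₗ[ℝ] ℝ where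
  toFun P := hamiltonianAt g P x
  map_add' P Q := by
    simp only [hamiltonianAt_three, euler_eq_eulerDerivation, map_add]; ring
  map_smul' c P := by
    simp only [hamiltonianAt_three, euler_eq_eulerDerivation, Derivation.map_smul, smul_eval, RingHom.id_apply,
      smul_eq_mul]
    ring

theorem eigenvalue_eq (g : ℝ) (l : Fin 3 → ℕ) (hl : Antitone l) :
    eigenvalue g l = elementaryEigenvalue g (l12 l) (l23 l) (l 2) := by
  have h1 : l 1 ≤ l 0 := hl (by decide)
  have h2 : l 2 ≤ l 1 := hl (by decide)
  simp only [eigenvalue, Fin.sum_univ_three, elementaryEigenvalue, l12, l23, Nat.cast_sub h1,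
    Nat.cast_sub h2]
  simp only [Fin.val_zero, Fin.val_one, Fin.val_two]
  push_cast
  ring

theorem hamiltonianAt_jackPoly {α β ℓ : ℕ} {g : ℝ} (hg : 0 < g) {x : Fin 3 → ℝ}
    (hx : Function.Injective x) : hamiltonianAt g (jackPoly α β ℓ g) x =
      elementaryEigenvalue g α β ℓ * eval x (jackPoly α β ℓ g) := by
  have h := sum_jackCoeff_operator (M := ℝ) (α := α) (β := β) (ℓ := ℓ) hg
    (fun a b c => hamiltonianAt g (e₁ ^ a * e₂ ^ b * e₃ ^ c) x -
      elementaryEigenvalue g α β ℓ * eval x (e₁ ^ a * e₂ ^ b * e₃ ^ c))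
    (fun a b c => eval x (e₁ ^ a * e₂ ^ b * e₃ ^ c)) fun a b c _ => by
      rw [hamiltonianAt_monomial g hx]
      simp only [smul_eq_mul, elementaryEigenvalue]
      ring
  change hamiltonianLinear g x (jackPoly α β ℓ g) = _
  rw [← sub_eq_zero, ← h]
  simp only [jackPoly, map_sum, map_smul, Finset.mul_sum, ← Finset.sum_sub_distrib, smul_eval,
    smul_eq_mul, mul_sub]
  refine Finset.sum_congr rfl fun p _ => Finset.sum_congr rfl fun q _ => ?_
  change _ * hamiltonianAt _ _ _ - _ = _
  ring

/-- The term of index `(p, q)` has leading exponent $\lambda-p(1,-1,0)-q(0,1,-1)$, so only `(0, 0)`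
reaches $\lambda$. -/
theorem hasLeadingTerm_jackPoly (α β ℓ : ℕ) (g : ℝ) :
    HasLeadingTerm (jackPoly α β ℓ g) ![α + β + ℓ, β + ℓ, ℓ] where
  coeff_eq_one := by
    simp only [jackPoly, coeff_sum, coeff_smul]
    rw [Finset.sum_eq_single 0, Finset.sum_eq_single 0]
    · simpa [jackCoeff] using (hasLeadingTerm_monomial α β ℓ).coeff_eq_one
    · intro q _ hq
      by_cases hv : 2 * 0 ≤ α + q ∧ 2 * q ≤ β + 0
      · by_contra hc
        have := (dominated_iff _ _).1
          ((hasLeadingTerm_monomial _ _ _).dominated _ (right_ne_zero_of_mul hc))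
        simp at this
        omega
      · rw [jackCoeff_eq_zero hv, zero_smul]
    · simp
    · intro p _ hp
      refine Finset.sum_eq_zero fun q _ => ?_
      by_cases hv : 2 * p ≤ α + q ∧ 2 * q ≤ β + p
      · by_contra hc
        have := (dominated_iff _ _).1
          ((hasLeadingTerm_monomial _ _ _).dominated _ (right_ne_zero_of_mul hc))
        simp at this
        omega
      · rw [jackCoeff_eq_zero hv, zero_smul]
    · simp
  dominated ν h := by
    simp only [jackPoly, coeff_sum, coeff_smul] at h
    obtain ⟨p, _, hp⟩ := Finset.exists_ne_zero_of_sum_ne_zero h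
    obtain ⟨q, _, hq⟩ := Finset.exists_ne_zero_of_sum_ne_zero hp
    have hv : 2 * p ≤ α + q ∧ 2 * q ≤ β + p := by
      by_contra hv
      exact hq (by rw [jackCoeff_eq_zero hv, zero_smul])
    have := (dominated_iff _ _).1
      ((hasLeadingTerm_monomial _ _ _).dominated _ (right_ne_zero_of_mul hq))
    rw [dominated_iff]
    simp at this ⊢
    omega

theorem isJack_jackPoly {l : Fin 3 → ℕ} (hl : Antitone l) {g : ℝ} (hg : 0 < g) :
    IsJack g l (jackPoly (l12 l) (l23 l) (l 2) g) := by
  have h1 : l 1 ≤ l 0 := hl (by decide)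
  have h2 : l 2 ≤ l 1 := hl (by decide)
  have hlead := hasLeadingTerm_jackPoly (l12 l) (l23 l) (l 2) g
  have e : ![l12 l + l23 l + l 2, l23 l + l 2, l 2] = l := by
    ext i; fin_cases i <;> simp [l12, l23] <;> omega
  rw [e] at hlead
  refine ⟨?_, hlead.coeff_eq_one, fun μ _ h => ?_, fun x hx => ?_⟩
  · exact isSymmetric_sum _ _ fun p _ => isSymmetric_sum _ _ fun q _ =>
      (((isSymmetric_pow isSymmetric_e₁ _).mul (isSymmetric_pow isSymmetric_e₂ _)).mul
        (isSymmetric_pow isSymmetric_e₃ _)).smul _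
  · simpa using hlead.dominated _ h
  · rw [hamiltonianAt_jackPoly hg hx, eigenvalue_eq g l hl]

end Existence

/-! ### Uniqueness of the Jack polynomial. -/

section Uniqueness

theorem coeff_euler {n : ℕ} (i : Fin n) (P : MvPolynomial (Fin n) ℝ) (ν : Fin n →₀ ℕ) :
    coeff ν (euler i P) = ν i * coeff ν P := by
  induction P using MvPolynomial.induction_on' with
  | monomial s a =>
    rw [euler, pderiv_monomial, X, monomial_mul, one_mul]
    by_cases hs : s i = 0
    · by_cases h : s = ν
      · subst h; simp [hs]
      · simp [hs, coeff_monomial, h]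
    · have : Finsupp.single i 1 + (s - Finsupp.single i 1) = s :=
        add_tsub_cancel_of_le (by simpa using Nat.one_le_iff_ne_zero.2 hs)
      rw [this, coeff_monomial, coeff_monomial]
      split_ifs with h
      · subst h; ring
      · simp
  | add p q hp hq =>
    rw [euler_eq_eulerDerivation, map_add, coeff_add, ← euler_eq_eulerDerivation,
      ← euler_eq_eulerDerivation, hp, hq, coeff_add]
    ring

/-- All exponents of `P` are at most `a` in the lexicographic order, and the coefficient of `x ^ a`
is `c`. -/
def LexTop (P : MvPolynomial (Fin 3) ℝ) (a : Fin 3 →₀ ℕ) (c : ℝ) : Prop :=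
  (∀ ν, coeff ν P ≠ 0 → toLex ν ≤ toLex a) ∧ coeff a P = c

/-- The exponent is only an upper bound and the coefficient may be zero. This makes `LexTop` stable
under sums, differences and Euler operators, where cancellation can occur. -/
theorem LexTop.mul {P Q : MvPolynomial (Fin 3) ℝ} {a b : Fin 3 →₀ ℕ} {c d : ℝ}
    (hP : LexTop P a c) (hQ : LexTop Q b d) : LexTop (P * Q) (a + b) (c * d) := by
  have h1 : (MonomialOrder.lex.toSyn (MonomialOrder.lex.degree P)) ≤ MonomialOrder.lex.toSyn a :=
    MonomialOrder.lex.degree_le_iff.2 fun ν hν => hP.1 ν (mem_support_iff.1 hν)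
  have h2 : (MonomialOrder.lex.toSyn (MonomialOrder.lex.degree Q)) ≤ MonomialOrder.lex.toSyn b :=
    MonomialOrder.lex.degree_le_iff.2 fun ν hν => hQ.1 ν (mem_support_iff.1 hν)
  constructor
  · intro ν hν
    have h3 := MonomialOrder.lex.le_degree (mem_support_iff.2 hν)
    have h4 := MonomialOrder.lex.degree_mul_le (f := P) (g := Q)
    have h5 : MonomialOrder.lex.toSyn (MonomialOrder.lex.degree P + MonomialOrder.lex.degree Q) ≤
        MonomialOrder.lex.toSyn (a + b) := by
      rw [map_add, map_add]; exact add_le_add h1 h2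
    exact h3.trans (h4.trans h5)
  · rw [MonomialOrder.lex.coeff_mul_of_add_of_degree_le h1 h2, hP.2, hQ.2]

theorem LexTop.add {P Q : MvPolynomial (Fin 3) ℝ} {a : Fin 3 →₀ ℕ} {c d : ℝ}
    (hP : LexTop P a c) (hQ : LexTop Q a d) : LexTop (P + Q) a (c + d) := by
  refine ⟨fun ν hν => ?_, by rw [coeff_add, hP.2, hQ.2]⟩
  by_contra h
  refine hν ?_
  rw [coeff_add, not_not.1 (mt (hP.1 ν) h), not_not.1 (mt (hQ.1 ν) h), add_zero]

theorem LexTop.smul {P : MvPolynomial (Fin 3) ℝ} {a : Fin 3 →₀ ℕ} {c : ℝ}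
    (hP : LexTop P a c) (r : ℝ) : LexTop (r • P) a (r * c) := by
  refine ⟨fun ν hν => hP.1 ν fun h => hν (by simp [h]), by simp [hP.2]⟩

theorem LexTop.sub {P Q : MvPolynomial (Fin 3) ℝ} {a : Fin 3 →₀ ℕ} {c d : ℝ}
    (hP : LexTop P a c) (hQ : LexTop Q a d) : LexTop (P - Q) a (c - d) := by
  have := hP.add (hQ.smul (-1))
  simpa [sub_eq_add_neg] using this

theorem LexTop.euler {P : MvPolynomial (Fin 3) ℝ} {a : Fin 3 →₀ ℕ} {c : ℝ}
    (hP : LexTop P a c) (i : Fin 3) : LexTop (euler i P) a (a i * c) := by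
  refine ⟨fun ν hν => hP.1 ν fun h => hν ?_, ?_⟩
  · rw [coeff_euler, h, mul_zero]
  · rw [coeff_euler, hP.2]

theorem lexTop_X_add {i j : Fin 3} (hij : i < j) (r : ℝ) :
    LexTop (X i + r • X j) (Finsupp.single i 1) 1 := by
  have hlt : toLex (Finsupp.single j 1 : Fin 3 →₀ ℕ) < toLex (Finsupp.single i 1) :=
    Finsupp.Lex.single_lt_iff.2 hij
  constructor
  · intro ν hν
    by_contra h
    refine hν ?_
    have h1 : Finsupp.single i 1 ≠ ν := fun e => h (by rw [e])
    have h2 : Finsupp.single j 1 ≠ ν := fun e => h (by rw [← e]; exact hlt.le)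
    simp [coeff_X, h1, h2]
  · have : (Finsupp.single j 1 : Fin 3 →₀ ℕ) ≠ Finsupp.single i 1 := fun e => by
      rw [e] at hlt; exact lt_irrefl _ hlt
    simp [coeff_X, this]

theorem lexTop_X_add_X {i j : Fin 3} (hij : i < j) :
    LexTop (X i + X j) (Finsupp.single i 1) 1 := by
  simpa using lexTop_X_add hij 1

theorem lexTop_X_sub_X {i j : Fin 3} (hij : i < j) :
    LexTop (X i - X j) (Finsupp.single i 1) 1 := by
  simpa [sub_eq_add_neg] using lexTop_X_add hij (-1)

/-- If two entries were in increasing order, exchanging them would give, by symmetry, another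
exponent of `P` that is lexicographically larger. -/
theorem antitone_of_lexTop {P : MvPolynomial (Fin 3) ℝ} (hP : P.IsSymmetric) {a : Fin 3 →₀ ℕ}
    {c : ℝ} (ha : LexTop P a c) (hc : c ≠ 0) : Antitone a := by
  intro i j hij
  rcases hij.eq_or_lt with rfl | hij
  · exact le_rfl
  by_contra hlt
  have h1 : coeff (a.mapDomain (Equiv.swap i j)) P = c := by
    have := coeff_rename_mapDomain _ (Equiv.swap i j).injective P a
    rwa [hP, ha.2] at this
  have h2 := ha.1 _ (h1 ▸ hc)
  refine absurd h2 (not_le.2 (Finsupp.Lex.lt_iff.2 ⟨i, fun k hk => ?_, ?_⟩))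
  · simp [Finsupp.mapDomain_equiv_apply,
      Equiv.swap_apply_of_ne_of_ne hk.ne (hk.trans hij).ne]
  · simpa [Finsupp.mapDomain_equiv_apply] using hlt

theorem eigenvalue_lt {g : ℝ} (hg : 0 < g) {m l : Fin 3 → ℕ} (hm : Antitone m) (hl : Antitone l)
    (h : Dominated m l) (hne : m ≠ l) : eigenvalue g m < eigenvalue g l := by
  obtain ⟨h1, h2, h3⟩ := (dominated_iff m l).1 h
  have m1 : m 1 ≤ m 0 := hm (by decide)
  have m2 : m 2 ≤ m 1 := hm (by decide)
  have l1 : l 1 ≤ l 0 := hl (by decide)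
  have l2 : l 2 ≤ l 1 := hl (by decide)
  have hpos : m 0 < l 0 ∨ m 0 + m 1 < l 0 + l 1 := by
    by_contra hcon
    refine hne (funext fun i => ?_)
    fin_cases i <;> simp <;> omega
  -- Summation by parts: the difference is written through the differences of partial sums,
  -- nonnegative by dominance, with coefficients nonnegative because both sequences are antitone.
  have key : eigenvalue g l - eigenvalue g m =
      ((l 0 : ℝ) - m 0) * ((l 0 - l 1) + (m 0 - m 1)) +
      ((l 0 + l 1 : ℝ) - (m 0 + m 1)) * ((l 1 - l 2) + (m 1 - m 2)) +
      2 * g * ((l 0 - m 0) + ((l 0 + l 1) - (m 0 + m 1))) := by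
    have h1' : (m 2 : ℝ) = l 0 + l 1 + l 2 - m 0 - m 1 := by
      have : (m 0 + m 1 + m 2 : ℝ) = l 0 + l 1 + l 2 := by exact_mod_cast h1
      linarith
    simp only [eigenvalue, Fin.sum_univ_three, Fin.val_zero, Fin.val_one, Fin.val_two]
    rw [h1']
    push_cast
    ring
  have a1 : (m 1 : ℝ) ≤ m 0 := by exact_mod_cast m1
  have a2 : (m 2 : ℝ) ≤ m 1 := by exact_mod_cast m2
  have a3 : (l 1 : ℝ) ≤ l 0 := by exact_mod_cast l1
  have a4 : (l 2 : ℝ) ≤ l 1 := by exact_mod_cast l2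
  have a5 : (m 0 : ℝ) ≤ l 0 := by exact_mod_cast h2
  have a6 : (m 0 + m 1 : ℝ) ≤ l 0 + l 1 := by exact_mod_cast h3
  have a7 : (0 : ℝ) < (l 0 - m 0) + ((l 0 + l 1) - (m 0 + m 1)) := by
    rcases hpos with h | h
    · have : (m 0 : ℝ) < l 0 := by exact_mod_cast h
      linarith
    · have : (m 0 + m 1 : ℝ) < l 0 + l 1 := by exact_mod_cast h
      linarith
  have b1 := mul_nonneg (sub_nonneg.2 a5) (add_nonneg (sub_nonneg.2 a3) (sub_nonneg.2 a1))
  have b2 := mul_nonneg (sub_nonneg.2 a6) (add_nonneg (sub_nonneg.2 a4) (sub_nonneg.2 a2))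
  have b3 := mul_pos (mul_pos two_pos hg) a7
  linarith

/-- The eigenvalue equation of `H_g` with the denominators cleared. -/
theorem eigen_cleared {g E : ℝ} {R : MvPolynomial (Fin 3) ℝ}
    (h : ∀ x : Fin 3 → ℝ, Function.Injective x → hamiltonianAt g R x = E * eval x R) :
    (X 0 - X 1) * (X 0 - X 2) * (X 1 - X 2) *
        (euler 0 (euler 0 R) + euler 1 (euler 1 R) + euler 2 (euler 2 R) - E • R) +
      g • ((X 0 + X 1) * (X 0 - X 2) * (X 1 - X 2) * (euler 0 R - euler 1 R) +
        (X 0 - X 1) * (X 0 + X 2) * (X 1 - X 2) * (euler 0 R - euler 2 R) +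
        (X 0 - X 1) * (X 0 - X 2) * (X 1 + X 2) * (euler 1 R - euler 2 R)) = 0 := by
  have hne : ∀ i j : Fin 3, i < j → (X i - X j : MvPolynomial (Fin 3) ℝ) ≠ 0 := fun i j hij =>
    sub_ne_zero.2 fun e => hij.ne (X_injective e)
  have hΔ : (X 0 - X 1) * (X 0 - X 2) * (X 1 - X 2) ≠ (0 : MvPolynomial (Fin 3) ℝ) :=
    mul_ne_zero (mul_ne_zero (hne 0 1 (by decide)) (hne 0 2 (by decide))) (hne 1 2 (by decide))
  -- The eigenvalue equation is known only at points with distinct coordinates. An additional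
  -- Vandermonde factor makes the identity trivial at the other points, and is then cancelled in the
  -- polynomial ring.
  refine mul_left_cancel₀ hΔ (MvPolynomial.funext fun x => ?_)
  rw [mul_zero, map_mul, map_zero]
  by_cases hx : Function.Injective x
  · have h01 : x 0 - x 1 ≠ 0 := sub_ne_zero.2 (hx.ne (by decide))
    have h02 : x 0 - x 2 ≠ 0 := sub_ne_zero.2 (hx.ne (by decide))
    have h12 : x 1 - x 2 ≠ 0 := sub_ne_zero.2 (hx.ne (by decide))
    have hx' := h x hx
    rw [hamiltonianAt_three] at hx'
    simp only [map_add, map_sub, map_mul, eval_X, smul_eval]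
    have e : ∀ A B C D G : ℝ, A + g * ((x 0 + x 1) / (x 0 - x 1) * B +
        (x 0 + x 2) / (x 0 - x 2) * C + (x 1 + x 2) / (x 1 - x 2) * D) = G →
        (x 0 - x 1) * (x 0 - x 2) * (x 1 - x 2) * (A - G) +
        g * ((x 0 + x 1) * (x 0 - x 2) * (x 1 - x 2) * B +
        (x 0 - x 1) * (x 0 + x 2) * (x 1 - x 2) * C +
        (x 0 - x 1) * (x 0 - x 2) * (x 1 + x 2) * D) = 0 := by
      intro A B C D G hG
      rw [← hG]; field_simp; ring
    rw [e _ _ _ _ _ hx', mul_zero]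
  · have : eval x ((X 0 - X 1) * (X 0 - X 2) * (X 1 - X 2) : MvPolynomial (Fin 3) ℝ) = 0 := by
      simp only [map_sub, map_mul, eval_X]
      by_contra hc
      refine hx fun i j hij => ?_
      have h3 := sub_ne_zero.1 (right_ne_zero_of_mul hc)
      have h1 := sub_ne_zero.1 (left_ne_zero_of_mul (left_ne_zero_of_mul hc))
      have h2 := sub_ne_zero.1 (right_ne_zero_of_mul (left_ne_zero_of_mul hc))
      fin_cases i <;> fin_cases j <;> simp_all
    rw [this, zero_mul]

/-- For $i<j$ both $x_i+x_j$ and $x_i-x_j$ have lexicographic leading term $x_i$, so each quotient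
in $H_g$ acts on leading terms like 1. The coefficient of the cleared equation at $\mu+(2,1,0)$ is
$\pm c$ times the difference of `E` and the eigenvalue of $\mu$. -/
theorem eigenvalue_eq_of_lexTop {g E : ℝ} {R : MvPolynomial (Fin 3) ℝ}
    (h : ∀ x : Fin 3 → ℝ, Function.Injective x → hamiltonianAt g R x = E * eval x R)
    {μ : Fin 3 →₀ ℕ} {c : ℝ} (hR : LexTop R μ c) (hc : c ≠ 0) : eigenvalue g μ = E := by
  have t01 := lexTop_X_sub_X (i := 0) (j := 1) (by decide)
  have t02 := lexTop_X_sub_X (i := 0) (j := 2) (by decide)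
  have t12 := lexTop_X_sub_X (i := 1) (j := 2) (by decide)
  have s01 := lexTop_X_add_X (i := 0) (j := 1) (by decide)
  have s02 := lexTop_X_add_X (i := 0) (j := 2) (by decide)
  have s12 := lexTop_X_add_X (i := 1) (j := 2) (by decide)
  have hH := (((((hR.euler 0).euler 0).add ((hR.euler 1).euler 1)).add
    ((hR.euler 2).euler 2)).sub (hR.smul E))
  have d01 := ((s01.mul t02).mul t12).mul ((hR.euler 0).sub (hR.euler 1))
  have d02 := ((t01.mul s02).mul t12).mul ((hR.euler 0).sub (hR.euler 2))
  have d12 := ((t01.mul t02).mul s12).mul ((hR.euler 1).sub (hR.euler 2))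
  have htot := (((t01.mul t02).mul t12).mul hH).add (((d01.add d02).add d12).smul g)
  have h0 := htot.2
  rw [eigen_cleared h, coeff_zero] at h0
  have : c * (eigenvalue g μ - E) = 0 := by
    simp only [eigenvalue, Fin.sum_univ_three, Fin.val_zero, Fin.val_one, Fin.val_two]
    push_cast
    linear_combination -h0
  rcases mul_eq_zero.1 this with h | h
  · exact absurd h hc
  · linarith

theorem IsJack.unique {l : Fin 3 → ℕ} (hl : Antitone l) {g : ℝ} (hg : 0 < g)
    {P Q : MvPolynomial (Fin 3) ℝ} (hP : IsJack g l P) (hQ : IsJack g l Q) : P = Q := by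
  by_contra hne
  have hR : P - Q ≠ 0 := sub_ne_zero.2 hne
  have htop : LexTop (P - Q) (MonomialOrder.lex.degree (P - Q))
      (coeff (MonomialOrder.lex.degree (P - Q)) (P - Q)) :=
    ⟨fun ν hν => MonomialOrder.lex.le_degree (mem_support_iff.2 hν), rfl⟩
  have hc : coeff (MonomialOrder.lex.degree (P - Q)) (P - Q) ≠ 0 :=
    MonomialOrder.lex.coeff_degree_ne_zero_iff.2 hR
  generalize MonomialOrder.lex.degree (P - Q) = μ at *
  have hμ : Antitone μ := antitone_of_lexTop (hP.symmetric.sub hQ.symmetric) htop hc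
  have hμ' : Finsupp.equivFunOnFinite.symm (μ : Fin 3 → ℕ) = μ := by ext; simp
  have hdom : Dominated μ l := by
    rw [coeff_sub] at hc
    by_cases h : coeff μ P = 0
    · exact hQ.triangular μ hμ (by rw [hμ']; rintro h'; simp [h, h'] at hc)
    · exact hP.triangular μ hμ (by rwa [hμ'])
  have hμl : (μ : Fin 3 → ℕ) ≠ l := by
    intro h
    rw [h] at hμ'
    exact hc (by rw [coeff_sub, ← hμ', hP.leading, hQ.leading, sub_self])
  refine (eigenvalue_lt hg hμ hl hdom hμl).ne (eigenvalue_eq_of_lexTop (fun x hx => ?_) htop hc)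
  change hamiltonianLinear g x (P - Q) = _
  rw [map_sub, map_sub, mul_sub]
  congr 1
  · exact hP.eigen x hx
  · exact hQ.eigen x hx

end Uniqueness

end Jack

namespace Jack

open Polynomial

/-! ### The operator in the variables $u$ (inner, `C X`) and $v$ (outer, `X`). -/

section Bivariate

/-- The derivative in the inner variable `u` of a polynomial in `u` and `v`. -/
noncomputable def derivU : Derivation ℝ ℝ[X][X] ℝ[X][X] :=
  PolynomialModule.equivPolynomialSelf.compDer (derivative'.mapCoeffs)

/-- The derivative in the outer variable `v` of a polynomial in `u` and `v`. -/
noncomputable def derivV : Derivation ℝ ℝ[X][X] ℝ[X][X] :=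
  (derivative' : Derivation ℝ[X] ℝ[X][X] ℝ[X][X]).restrictScalars ℝ

theorem coeff_derivU (f : ℝ[X][X]) (n : ℕ) : (derivU f).coeff n = derivative (f.coeff n) := rfl

theorem derivV_apply (f : ℝ[X][X]) : derivV f = derivative f := rfl

theorem derivU_X : derivU X = 0 := by
  ext1 n
  rw [coeff_derivU, coeff_X]
  split_ifs <;> simp

theorem derivU_C_X : derivU (C X) = 1 := by
  ext1 n
  rw [coeff_derivU, coeff_C, coeff_one]
  split_ifs <;> simp_all

theorem derivV_C (p : ℝ[X]) : derivV (C p) = 0 := by simp [derivV_apply]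

/-- `v` times `H_g - E`, where `H_g` acts on homogeneous functions of degree `d` written in the
variables `u = x₁x₂/x₃²` and `v = (1 - x₁/x₃)(1 - x₂/x₃)`. -/
noncomputable def uvOperator (d g E : ℝ) : ℝ[X][X] →ₗ[ℝ] ℝ[X][X] where
  toFun f :=
    C (6 * X ^ 2) * (X * derivU (derivU f)) + C (C (6 - 4 * d) * X) * (X * derivU f) +
    C (C (6 * g) * (X * (X - 1))) * derivU f + C (6 * (X * (X - 1))) * (X * derivV (derivU f)) +
    C (6 * X) * (X * (X * derivV (derivU f))) + C (2 * (1 - X) ^ 2) * (X * derivV (derivV f)) +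
    C (2 * (X - 2)) * (X * (X * derivV (derivV f))) +
    C 2 * (X * (X * (X * derivV (derivV f)))) +
    C (C (2 - 2 * d) * (X - 1) + 2 * X - C (6 * g)) * (X * derivV f) +
    C (C (2 - 2 * d + 2 * g)) * (X * (X * derivV f)) + C (C (4 * g) * (1 - X) ^ 2) * derivV f +
    C (C (d ^ 2 - E)) * (X * f) - C (C (2 * g * d) * (X - 1)) * f
  map_add' f h := by simp only [map_add]; ring
  map_smul' r f := by
    simp only [Derivation.map_smul, RingHom.id_apply]
    simp only [Algebra.smul_def]
    ring

theorem uvOperator_apply (d g E : ℝ) (f : ℝ[X][X]) : uvOperator d g E f =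
    C (6 * X ^ 2) * (X * derivU (derivU f)) + C (C (6 - 4 * d) * X) * (X * derivU f) +
    C (C (6 * g) * (X * (X - 1))) * derivU f + C (6 * (X * (X - 1))) * (X * derivV (derivU f)) +
    C (6 * X) * (X * (X * derivV (derivU f))) + C (2 * (1 - X) ^ 2) * (X * derivV (derivV f)) +
    C (2 * (X - 2)) * (X * (X * derivV (derivV f))) +
    C 2 * (X * (X * (X * derivV (derivV f)))) +
    C (C (2 - 2 * d) * (X - 1) + 2 * X - C (6 * g)) * (X * derivV f) +
    C (C (2 - 2 * d + 2 * g)) * (X * (X * derivV f)) + C (C (4 * g) * (1 - X) ^ 2) * derivV f +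
    C (C (d ^ 2 - E)) * (X * f) - C (C (2 * g * d) * (X - 1)) * f := rfl

/-- The value of `e₁` in the variables `u`, `v` at `x₃ = 1`. -/
noncomputable def s₁ : ℝ[X][X] := 2 + C X - X

/-- The value of `e₂` in the variables `u`, `v` at `x₃ = 1`. -/
noncomputable def s₂ : ℝ[X][X] := 1 + 2 * C X - X

theorem derivU_s₁ : derivU s₁ = 1 := by
  have := Derivation.map_natCast derivU 2
  rw [s₁, map_sub, map_add, derivU_X, derivU_C_X, show (2 : ℝ[X][X]) = ((2 : ℕ) : ℝ[X][X]) by simp,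
    this]
  ring

theorem derivU_s₂ : derivU s₂ = 2 := by
  have := Derivation.map_natCast derivU 2
  rw [s₂, map_sub, map_add, derivation_mul, derivU_X, derivU_C_X, Derivation.map_one_eq_zero,
    show (2 : ℝ[X][X]) = ((2 : ℕ) : ℝ[X][X]) by simp, this]
  ring

theorem derivV_s₁ : derivV s₁ = -1 := by simp [s₁, derivV_apply]

theorem derivV_s₂ : derivV s₂ = -1 := by simp [s₂, derivV_apply]

/-- This is `elementary_operator_monomial` transported by the chain rule to functions of $u,v$.
Homogeneity of degree `d` replaces the derivative in $x_3$. The factor $v$ clears the denominators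
of the pairs involving $x_3$, whose product at $x_3=1$ is $v$. -/
theorem uvOperator_monomial {d g E : ℝ} {a b c : ℕ} (h : (a + 2 * b + 3 * c : ℝ) = d) :
    uvOperator d g E (s₁ ^ a * s₂ ^ b * C X ^ c) =
      (elementaryEigenvalue g a b c - E) • (X * (s₁ ^ a * s₂ ^ b * C X ^ c)) -
      (2 * a * (a - 1) : ℝ) • (X * (s₁ ^ (a - 2) * s₂ ^ (b + 1) * C X ^ c)) -
      (6 * a * b : ℝ) • (X * (s₁ ^ (a - 1) * s₂ ^ (b - 1) * C X ^ (c + 1))) -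
      (2 * b * (b - 1) : ℝ) • (X * (s₁ ^ (a + 1) * s₂ ^ (b - 2) * C X ^ (c + 1))) := by
  have key := elementary_operator_monomial (C (C g)) s₁ s₂ (C X : ℝ[X][X]) a b c
  have hd : (a + 2 * b + 3 * c : ℝ[X][X]) = C (C d) := by
    rw [← h]; simp only [map_add, map_mul, map_natCast, map_ofNat]
  have a1 := mul_powDeriv s₁ a
  have a2 := mul_powDeriv₂ s₁ a
  have b1 := mul_powDeriv s₂ b
  have b2 := mul_powDeriv₂ s₂ b
  have c1 := mul_powDeriv (C X : ℝ[X][X]) c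
  have c2 := mul_powDeriv₂ (C X : ℝ[X][X]) c
  have hE : algebraMap ℝ ℝ[X][X] (elementaryEigenvalue g a b c - E) =
      (a + b + c) ^ 2 + (b + c) ^ 2 + c ^ 2 + 2 * C (C g) * (a + b) - C (C E) := by
    simp only [elementaryEigenvalue, map_add, map_mul, map_sub, map_pow, map_natCast, map_ofNat]
    rfl
  have hx : algebraMap ℝ ℝ[X][X] (2 * a * (a - 1) : ℝ) = 2 * a * (a - 1) := by
    simp only [map_mul, map_sub, map_natCast, map_ofNat, map_one]
  have hy : algebraMap ℝ ℝ[X][X] (6 * a * b : ℝ) = 6 * a * b := by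
    simp only [map_mul, map_natCast, map_ofNat]
  have hz : algebraMap ℝ ℝ[X][X] (2 * b * (b - 1) : ℝ) = 2 * b * (b - 1) := by
    simp only [map_mul, map_sub, map_natCast, map_ofNat, map_one]
  rw [Algebra.smul_def, Algebra.smul_def, Algebra.smul_def, Algebra.smul_def, hE, hx, hy, hz]
  have rhs : ∀ K A B G D W : ℝ[X][X], (K - C (C E)) * (X * W) - A * (X * B) - G * (X * D) =
      X * (K * W - A * B - G * D - C (C E) * W) := fun K A B G D W => by ring
  rw [uvOperator_apply]
  simp only [derivation_derivation_monomial]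
  simp only [derivation_monomial, derivU_s₁, derivU_s₂, derivV_s₁,
    derivV_s₂, derivU_C_X, derivV_C, Derivation.map_one_eq_zero, map_zero]
  have d2 : derivU (2 : ℝ[X][X]) = 0 := by
    simpa using Derivation.map_natCast derivU 2
  have d2' : derivV (2 : ℝ[X][X]) = 0 := by
    simpa using Derivation.map_natCast derivV 2
  have d3' : derivV (-1 : ℝ[X][X]) = 0 := by simp
  simp only [d2, d2', d3', map_mul, map_sub, map_pow, map_add, map_one, map_ofNat]
  -- Euler's homogeneity relation with weights 1, 2, 3, for the monomial and then for its three
  -- first derivatives; it eliminates `d`.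
  have h0 : C (C d) * (s₁ ^ a * s₂ ^ b * C X ^ c) = s₁ * (powDeriv s₁ a * s₂ ^ b * C X ^ c) +
      2 * s₂ * (s₁ ^ a * powDeriv s₂ b * C X ^ c) +
      3 * C X * (s₁ ^ a * s₂ ^ b * powDeriv (C X : ℝ[X][X]) c) := by
    rw [← hd]
    linear_combination -(s₂ ^ b * C X ^ c) * a1 - 2 * (s₁ ^ a * C X ^ c) * b1 -
      3 * (s₁ ^ a * s₂ ^ b) * c1
  have h1 : C (C d) * (powDeriv s₁ a * s₂ ^ b * C X ^ c) =
      s₁ * (powDeriv₂ s₁ a * s₂ ^ b * C X ^ c) + powDeriv s₁ a * s₂ ^ b * C X ^ c +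
      2 * s₂ * (powDeriv s₁ a * powDeriv s₂ b * C X ^ c) +
      3 * C X * (powDeriv s₁ a * s₂ ^ b * powDeriv (C X : ℝ[X][X]) c) := by
    rw [← hd]
    linear_combination -(s₂ ^ b * C X ^ c) * a2 - 2 * (powDeriv s₁ a * C X ^ c) * b1 -
      3 * (powDeriv s₁ a * s₂ ^ b) * c1
  have h2 : C (C d) * (s₁ ^ a * powDeriv s₂ b * C X ^ c) =
      s₁ * (powDeriv s₁ a * powDeriv s₂ b * C X ^ c) +
      2 * s₂ * (s₁ ^ a * powDeriv₂ s₂ b * C X ^ c) + 2 * (s₁ ^ a * powDeriv s₂ b * C X ^ c) +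
      3 * C X * (s₁ ^ a * powDeriv s₂ b * powDeriv (C X : ℝ[X][X]) c) := by
    rw [← hd]
    linear_combination -(powDeriv s₂ b * C X ^ c) * a1 - 2 * (s₁ ^ a * C X ^ c) * b2 -
      3 * (s₁ ^ a * powDeriv s₂ b) * c1
  have h3 : C (C d) * (s₁ ^ a * s₂ ^ b * powDeriv (C X : ℝ[X][X]) c) =
      s₁ * (powDeriv s₁ a * s₂ ^ b * powDeriv (C X : ℝ[X][X]) c) +
      2 * s₂ * (s₁ ^ a * powDeriv s₂ b * powDeriv (C X : ℝ[X][X]) c) +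
      3 * C X * (s₁ ^ a * s₂ ^ b * powDeriv₂ (C X : ℝ[X][X]) c) +
      3 * (s₁ ^ a * s₂ ^ b * powDeriv (C X : ℝ[X][X]) c) := by
    rw [← hd]
    linear_combination -(s₂ ^ b * powDeriv (C X : ℝ[X][X]) c) * a1 -
      2 * (s₁ ^ a * powDeriv (C X : ℝ[X][X]) c) * b1 -
      3 * (s₁ ^ a * s₂ ^ b) * c2
  have hs1 : s₁ = 2 + C X - X := rfl
  have hs2 : s₂ = 1 + 2 * C X - X := rfl
  clear a1 a2 b1 b2 c1 c2 hE hx hy hz rhs hd d2 d2' d3' h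
  generalize s₁ ^ (a - 2) * s₂ ^ (b + 1) * C X ^ c = W1 at *
  generalize s₁ ^ (a - 1) * s₂ ^ (b - 1) * C X ^ (c + 1) = W2 at *
  generalize s₁ ^ (a + 1) * s₂ ^ (b - 2) * C X ^ (c + 1) = W3 at *
  generalize powDeriv₂ s₁ a = A2 at *
  generalize powDeriv₂ s₂ b = B2 at *
  generalize powDeriv₂ (C X : ℝ[X][X]) c = C2 at *
  generalize powDeriv s₁ a = A1 at *
  generalize powDeriv s₂ b = B1 at *
  generalize powDeriv (C X : ℝ[X][X]) c = C1 at *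
  generalize s₁ ^ a = A0 at *
  generalize s₂ ^ b = B0 at *
  generalize (C X : ℝ[X][X]) ^ c = C0 at *
  rw [hs1, hs2] at *
  generalize (C (C d) : ℝ[X][X]) = δ at *
  generalize (C (C g) : ℝ[X][X]) = γ at *
  generalize (C (C E) : ℝ[X][X]) = ε at *
  generalize (C X : ℝ[X][X]) = u at *
  generalize (X : ℝ[X][X]) = v at *
  linear_combination v * key + (v * δ - 2 * γ * (u - 1)) * h0 +
    (v * (2 + u - v) - 2 * v * (2 * u - (u + v - 1))) * h1 +
    (2 * v * (1 + 2 * u - v) - 2 * v * (4 * u - (u + v - 1))) * h2 + (3 * u * v - 4 * u * v) * h3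

end Bivariate

/-! ### From the differential operator to the recurrence. -/

section Coefficients

variable {R : Type*} [CommRing R]

theorem coeff_X_mul_derivative (f : R[X]) (n : ℕ) :
    (X * derivative f).coeff n = n * f.coeff n := by
  rcases n with _ | n
  · simp
  · rw [coeff_X_mul, coeff_derivative]; push_cast; ring

theorem coeff_X_mul_derivative_derivative (f : R[X]) (n : ℕ) :
    (X * derivative (derivative f)).coeff n = n * (n + 1) * f.coeff (n + 1) := by
  rw [coeff_X_mul_derivative, coeff_derivative]; ring

theorem coeff_X_sq_mul_derivative_derivative (f : R[X]) (n : ℕ) :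
    (X * (X * derivative (derivative f))).coeff n = n * (n - 1) * f.coeff n := by
  rcases n with _ | n
  · simp
  · rw [coeff_X_mul, coeff_X_mul_derivative_derivative]; push_cast; ring

theorem coeff_X_sq_mul_derivative (f : R[X]) (n : ℕ) :
    (X * (X * derivative f)).coeff n = ((n : R) - 1) * (X * f).coeff n := by
  rcases n with _ | n
  · simp
  · rw [coeff_X_mul, coeff_X_mul_derivative, coeff_X_mul]; push_cast; ring

theorem shiftRow_eq_coeff (f : ℝ[X][X]) (m n : ℕ) :
    shiftRow (fun i j => (f.coeff j).coeff i) m n = (X * f.coeff n).coeff m := by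
  rcases m with _ | m
  · simp [shiftRow]
  · rw [shiftRow, coeff_X_mul]

theorem shiftRow_shiftRow_eq_coeff (f : ℝ[X][X]) (m n : ℕ) :
    shiftRow (shiftRow (fun i j => (f.coeff j).coeff i)) m n =
      (X * (X * f.coeff n)).coeff m := by
  rcases m with _ | m
  · simp [shiftRow]
  · rw [shiftRow, coeff_X_mul, shiftRow_eq_coeff]

theorem coeff_uvOperator (d g E : ℝ) (f : ℝ[X][X]) (n : ℕ) :
    (uvOperator d g E f).coeff (n + 1) =
      6 * (X * (X * derivative (derivative (f.coeff n)))) +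
      C (6 - 4 * d + 6 * n) * (X * derivative (f.coeff n)) +
      C (6 * (g + n + 1)) * (X * (X * derivative (f.coeff (n + 1))) -
        X * derivative (f.coeff (n + 1))) +
      C (2 * (n + 2) * (n + 1 + 2 * g)) *
        (f.coeff (n + 2) - 2 * (X * f.coeff (n + 2)) + X * (X * f.coeff (n + 2))) +
      C ((n + 1) * (2 * n + 4 - 2 * d) - 2 * g * d) * (X * f.coeff (n + 1)) -
      C ((n + 1) * (4 * n + 2 - 2 * d + 6 * g) - 2 * g * d) * f.coeff (n + 1) +
      C (2 * n * (n - 1) + (2 - 2 * d + 2 * g) * n + d ^ 2 - E) * f.coeff n := by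
  simp only [uvOperator_apply, coeff_add, coeff_sub, coeff_C_mul, coeff_X_mul, coeff_derivU,
    derivV_apply, coeff_X_mul_derivative, coeff_derivative,
    coeff_X_sq_mul_derivative_derivative]
  simp only [map_add, map_sub, map_mul, map_pow, map_ofNat, map_natCast, map_one]
  push_cast
  ring

/-- An element of the kernel of `uvOperator` has coefficients satisfying the recurrence. -/
theorem recurrence_of_uvOperator_eq_zero {N b g : ℝ} {f : ℝ[X][X]}
    (h : uvOperator (N + b) g (N * (N + 2 * g) + b ^ 2) f = 0) :
    Recurrence N b g (fun m n => (f.coeff n).coeff m) := by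
  intro m n
  -- The index `n + 1` compensates for the factor $v$ in the operator.
  have key := congrArg (fun p : ℝ[X][X] => (p.coeff (n + 1)).coeff m) h
  simp only [coeff_uvOperator, coeff_add, coeff_sub, coeff_C_mul, coeff_ofNat_mul,
    coeff_X_mul_derivative, coeff_X_sq_mul_derivative,
    coeff_zero] at key
  rw [shiftRow_eq_coeff, shiftRow_eq_coeff, shiftRow_shiftRow_eq_coeff]
  simp only [recDiag, recUp, recSide]
  linear_combination key

end Coefficients

/-! ### Total degree in $u,v$ and the top coefficient. -/

section TotalDegree

/-- The polynomial `f` in `u` and `v` has total degree at most `N`. -/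
def TotalDegreeLE (f : ℝ[X][X]) (N : ℕ) : Prop :=
  ∀ m n : ℕ, N < m + n → (f.coeff n).coeff m = 0

theorem TotalDegreeLE.mul {f h : ℝ[X][X]} {M N : ℕ} (hf : TotalDegreeLE f M)
    (hh : TotalDegreeLE h N) : TotalDegreeLE (f * h) (M + N) := by
  intro m n hmn
  rw [coeff_mul, finsetSum_coeff]
  refine Finset.sum_eq_zero fun i hi => ?_
  rw [coeff_mul]
  refine Finset.sum_eq_zero fun j hj => ?_
  have hi := Finset.HasAntidiagonal.mem_antidiagonal.1 hi
  have hj := Finset.HasAntidiagonal.mem_antidiagonal.1 hj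
  by_cases hij : M < j.1 + i.1
  · rw [hf _ _ hij, zero_mul]
  · rw [hh _ _ (by omega), mul_zero]

theorem totalDegreeLE_one : TotalDegreeLE 1 0 := by
  intro m n hmn
  rw [coeff_one]
  split_ifs with h
  · rw [coeff_one, if_neg (by omega)]
  · simp

theorem TotalDegreeLE.pow {f : ℝ[X][X]} {M : ℕ} (hf : TotalDegreeLE f M) (k : ℕ) :
    TotalDegreeLE (f ^ k) (k * M) := by
  induction k with
  | zero => simpa using totalDegreeLE_one
  | succ k ih => rw [pow_succ, Nat.succ_mul]; exact ih.mul hf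

theorem totalDegreeLE_C_X : TotalDegreeLE (C X) 1 := by
  intro m n hmn
  rw [coeff_C]
  split_ifs with h
  · rw [coeff_X, if_neg (by omega)]
  · simp

theorem s₁_eq : s₁ = C (2 + X) - X := by
  simp only [s₁, map_add, map_ofNat]

theorem s₂_eq : s₂ = C (1 + 2 * X) - X := by
  simp only [s₂, map_add, map_mul, map_ofNat, map_one]

theorem totalDegreeLE_C_sub_X {r k : ℝ} : TotalDegreeLE (C (C r + C k * X) - X) 1 := by
  intro m n hmn
  rw [coeff_sub, coeff_C, coeff_X]
  rcases n with _ | _ | n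
  · have : ¬ m = 0 := by omega
    have : ¬ m = 1 := by omega
    simp [coeff_X, coeff_C, *, eq_comm]
  · have : ¬ m = 0 := by omega
    simp [coeff_one, *]
  · simp

theorem totalDegreeLE_s₁ : TotalDegreeLE s₁ 1 := by
  have := @totalDegreeLE_C_sub_X 2 1
  rwa [map_one, one_mul, map_ofNat, ← s₁_eq] at this

theorem totalDegreeLE_s₂ : TotalDegreeLE s₂ 1 := by
  have := @totalDegreeLE_C_sub_X 1 2
  rwa [map_one, map_ofNat, ← s₂_eq] at this

theorem totalDegreeLE_monomial (a b c : ℕ) :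
    TotalDegreeLE (s₁ ^ a * s₂ ^ b * C X ^ c) (a + b + c) := by
  simpa using ((totalDegreeLE_s₁.pow a).mul (totalDegreeLE_s₂.pow b)).mul (totalDegreeLE_C_X.pow c)

theorem coeff_s₁_pow_mul_s₂_pow (a b : ℕ) :
    ((s₁ ^ a * s₂ ^ b).coeff (a + b)).coeff 0 = (-1) ^ (a + b) := by
  -- Setting $u=0$ reduces the claim to the leading coefficient of $(2-v)^a(1-v)^b$.
  have hmap : ((s₁ ^ a * s₂ ^ b).map (evalRingHom (0 : ℝ))).coeff (a + b) =
      ((s₁ ^ a * s₂ ^ b).coeff (a + b)).coeff 0 := by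
    rw [coeff_map, coe_evalRingHom, coeff_zero_eq_eval_zero]
  have h1 : s₁.map (evalRingHom (0 : ℝ)) = C 2 - X := by simp [s₁_eq]
  have h2 : s₂.map (evalRingHom (0 : ℝ)) = C 1 - X := by simp [s₂_eq]
  have hdeg : ∀ r : ℝ, (C r - X : ℝ[X]).natDegree ≤ 1 := fun r => by compute_degree
  have hpow : ∀ (r : ℝ) (k : ℕ), ((C r - X : ℝ[X]) ^ k).coeff k = (-1) ^ k := fun r k => by
    have := coeff_pow_of_natDegree_le (m := k) (hdeg r)
    rw [mul_one] at this
    rw [this, coeff_sub, coeff_C_succ, coeff_X_one, zero_sub]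
  have hpdeg : ∀ (r : ℝ) (k : ℕ), ((C r - X : ℝ[X]) ^ k).natDegree ≤ k := fun r k => by
    simpa using natDegree_pow_le_of_le k (hdeg r)
  rw [← hmap, Polynomial.map_mul, Polynomial.map_pow, Polynomial.map_pow, h1, h2,
    coeff_mul_add_eq_of_natDegree_le (hpdeg 2 a) (hpdeg 1 b), hpow, hpow, pow_add]

end TotalDegree

/-! ### The Jack polynomial as a polynomial in $u,v$. -/

section JackPolynomial

/-- The polynomial in `u` and `v` representing the Jack polynomial at `x₃ = 1`, `λ₃ = 0`. -/
noncomputable def uvPoly (α β : ℕ) (g : ℝ) : ℝ[X][X] :=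
  ∑ p ∈ Finset.range (α + β + 2), ∑ q ∈ Finset.range (α + β + 2),
    jackCoeff α β g p q • (s₁ ^ (α + q - 2 * p) * s₂ ^ (β + p - 2 * q) * C X ^ q)

theorem coeff_uvPoly (α β : ℕ) (g : ℝ) (m n : ℕ) : ((uvPoly α β g).coeff n).coeff m =
    ∑ p ∈ Finset.range (α + β + 2), ∑ q ∈ Finset.range (α + β + 2), jackCoeff α β g p q *
      ((s₁ ^ (α + q - 2 * p) * s₂ ^ (β + p - 2 * q) * C X ^ q).coeff n).coeff m := by
  simp only [uvPoly, finsetSum_coeff, coeff_smul, smul_eq_mul]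

theorem continuousAt_coeff_uvPoly (α β : ℕ) {g : ℝ} (hg : 0 < g) (m n : ℕ) :
    ContinuousAt (fun t => ((uvPoly α β t).coeff n).coeff m) g := by
  simp only [coeff_uvPoly]
  refine tendsto_finsetSum _ fun p _ => tendsto_finsetSum _ fun q _ => ?_
  exact (continuousAt_jackCoeff hg p q).mul continuousAt_const

theorem coeff_uvPoly_eq_zero (α β : ℕ) (g : ℝ) {m n : ℕ} (h : α + β < m + n) :
    ((uvPoly α β g).coeff n).coeff m = 0 := by
  rw [coeff_uvPoly]
  refine Finset.sum_eq_zero fun p _ => Finset.sum_eq_zero fun q _ => ?_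
  by_cases hv : 2 * p ≤ α + q ∧ 2 * q ≤ β + p
  · rw [(totalDegreeLE_monomial _ _ _) m n (by omega), mul_zero]
  · rw [jackCoeff_eq_zero hv, zero_mul]

/-- Only the index `(0, 0)` contributes: for `q > 0` the term is divisible by $u$, and for `p > 0`
its total degree is at most $\alpha+\beta-p$. -/
theorem coeff_uvPoly_top (α β : ℕ) (g : ℝ) :
    ((uvPoly α β g).coeff (α + β)).coeff 0 = (-1) ^ (α + β) := by
  rw [coeff_uvPoly, Finset.sum_eq_single 0, Finset.sum_eq_single 0]
  · simpa [jackCoeff] using coeff_s₁_pow_mul_s₂_pow α β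
  · intro q _ hq
    rw [← map_pow, coeff_mul_C, mul_coeff_zero, coeff_X_pow, if_neg (Ne.symm hq), mul_zero, mul_zero]
  · simp
  · intro p _ hp
    refine Finset.sum_eq_zero fun q _ => ?_
    by_cases hv : 2 * p ≤ α + q ∧ 2 * q ≤ β + p
    · rw [(totalDegreeLE_monomial _ _ _) 0 (α + β) (by omega), mul_zero]
    · rw [jackCoeff_eq_zero hv, zero_mul]
  · simp

theorem recurrence_uvPoly (α β : ℕ) {g : ℝ} (hg : 0 < g) :
    Recurrence (α + β : ℕ) β g (fun m n => ((uvPoly α β g).coeff n).coeff m) := by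
  apply recurrence_of_uvOperator_eq_zero
  have hE : ((α + β : ℕ) : ℝ) * ((α + β : ℕ) + 2 * g) + (β : ℝ) ^ 2 =
      elementaryEigenvalue g α β (0 : ℕ) := by
    rw [elementaryEigenvalue]; push_cast; ring
  rw [hE]
  have h := sum_jackCoeff_operator (α := α) (β := β) (ℓ := 0) hg
    (fun a b c => uvOperator ((α + β : ℕ) + β) g (elementaryEigenvalue g α β (0 : ℕ))
      (s₁ ^ a * s₂ ^ b * C X ^ c))
    (fun a b c => X * (s₁ ^ a * s₂ ^ b * C X ^ c)) fun a b c habc => by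
      refine uvOperator_monomial ?_
      have : ((a + 2 * b + 3 * c : ℕ) : ℝ) = ((α + 2 * β + 3 * 0 : ℕ) : ℝ) := by rw [habc]
      push_cast at this ⊢
      linarith
  simpa only [uvPoly, map_sum, map_smul, zero_add] using h

end JackPolynomial

/-! ### Return to the variables $x_1,x_2,x_3$. -/

section Evaluation

/-- The evaluation of a polynomial in `u` and `v` at complex numbers. -/
noncomputable def evalUV (U V : ℂ) : ℝ[X][X] →+* ℂ :=
  eval₂RingHom (eval₂RingHom (algebraMap ℝ ℂ) U) V

theorem evalUV_X (U V : ℂ) : evalUV U V X = V := by simp [evalUV]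

theorem evalUV_C_X (U V : ℂ) : evalUV U V (C X) = U := by simp [evalUV]

theorem evalUV_smul (U V : ℂ) (r : ℝ) (f : ℝ[X][X]) : evalUV U V (r • f) = r * evalUV U V f := by
  rw [Algebra.smul_def, map_mul]
  congr 1
  change evalUV U V (C (C r)) = r
  simp [evalUV]

theorem evalUV_eq_sum {N : ℕ} {f : ℝ[X][X]} (hf : ∀ m n, N < m + n → (f.coeff n).coeff m = 0)
    (U V : ℂ) : evalUV U V f =
      ∑ p ∈ Finset.range (N + 1) ×ˢ Finset.range (N + 1) with p.1 + p.2 ≤ N,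
        (((f.coeff p.2).coeff p.1 : ℝ) : ℂ) * U ^ p.1 * V ^ p.2 := by
  have hdeg : f.natDegree < N + 1 := by
    rw [Nat.lt_succ_iff, natDegree_le_iff_coeff_eq_zero]
    intro n hn
    ext m
    simpa using hf m n (by omega)
  have hdeg' : ∀ n, (f.coeff n).natDegree < N + 1 := fun n => by
    rw [Nat.lt_succ_iff, natDegree_le_iff_coeff_eq_zero]
    exact fun m hm => hf m n (by omega)
  rw [Finset.sum_filter_of_ne, Finset.sum_product_right, evalUV, coe_eval₂RingHom,
    eval₂_eq_sum_range' _ hdeg]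
  · refine Finset.sum_congr rfl fun n _ => ?_
    rw [coe_eval₂RingHom, eval₂_eq_sum_range' _ (hdeg' n), Finset.sum_mul]
    rfl
  · intro p _ hp
    by_contra hlt
    exact hp (by rw [hf p.1 p.2 (by omega)]; simp)

theorem aeval_jackPoly (α β ℓ : ℕ) (g : ℝ) {x : Fin 3 → ℂ} (hx : x 2 ≠ 0) :
    MvPolynomial.aeval x (jackPoly α β ℓ g) = (x 0 * x 1) ^ ℓ * x 2 ^ (α + 2 * β + ℓ) *
      evalUV (x 0 * x 1 / x 2 ^ 2) ((1 - x 0 / x 2) * (1 - x 1 / x 2)) (uvPoly α β g) := by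
  set U := x 0 * x 1 / x 2 ^ 2 with hU
  set V := (1 - x 0 / x 2) * (1 - x 1 / x 2) with hV
  have h1 : MvPolynomial.aeval x e₁ = x 2 * evalUV U V s₁ := by
    simp only [e₁, s₁, map_add, map_sub, map_ofNat, evalUV_X, evalUV_C_X, MvPolynomial.aeval_X]
    rw [hU, hV]; field_simp; ring
  have h2 : MvPolynomial.aeval x e₂ = x 2 ^ 2 * evalUV U V s₂ := by
    simp only [e₂, s₂, map_add, map_sub, map_mul, map_ofNat, map_one, evalUV_X, evalUV_C_X,
      MvPolynomial.aeval_X]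
    rw [hU, hV]; field_simp; ring
  have h3 : MvPolynomial.aeval x e₃ = x 0 * x 1 * x 2 := by
    simp only [e₃, map_mul, MvPolynomial.aeval_X]
  have hU' : x 0 * x 1 = x 2 ^ 2 * U := by rw [hU]; field_simp
  simp only [jackPoly, uvPoly, map_sum, Finset.mul_sum, map_smul, evalUV_smul]
  refine Finset.sum_congr rfl fun p _ => Finset.sum_congr rfl fun q _ => ?_
  by_cases hv : 2 * p ≤ α + q ∧ 2 * q ≤ β + p
  · have hexp : α + 2 * β + ℓ =
        (α + q - 2 * p) + 2 * (β + p - 2 * q) + (ℓ + q) + 2 * q := by omega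
    rw [Complex.real_smul]
    simp only [map_mul, map_pow, h1, h2, h3, evalUV_C_X]
    rw [hexp, mul_pow (x 0 * x 1), pow_add (x 0 * x 1), hU']
    ring
  · rw [jackCoeff_eq_zero hv]; simp

theorem aeval_jackPoly_eq_expansion {l : Fin 3 → ℕ} (hl : Antitone l) (g : ℝ) {x : Fin 3 → ℂ}
    (hx : x 2 ≠ 0) : MvPolynomial.aeval x (jackPoly (l12 l) (l23 l) (l 2) g) =
      expansion l (fun m n => ((uvPoly (l12 l) (l23 l) g).coeff n).coeff m) x := by
  have h1 : l 1 ≤ l 0 := hl (by decide)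
  have h2 : l 2 ≤ l 1 := hl (by decide)
  have hN : l13 l = l12 l + l23 l := by simp only [l13, l12, l23]; omega
  have hexp : l12 l + 2 * l23 l + l 2 = l 0 + l 1 - l 2 := by simp only [l12, l23]; omega
  rw [aeval_jackPoly _ _ _ _ hx, expansion, hexp, hN,
    evalUV_eq_sum fun m n => coeff_uvPoly_eq_zero (l12 l) (l23 l) g]

theorem expansion_congr {l : Fin 3 → ℕ} {c c' : ℕ → ℕ → ℝ}
    (h : ∀ m n, m + n ≤ l13 l → c m n = c' m n) (x : Fin 3 → ℂ) :
    expansion l c x = expansion l c' x := by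
  rw [expansion, expansion]
  congr 1
  refine Finset.sum_congr rfl fun p hp => ?_
  rw [h p.1 p.2 (Finset.mem_filter.1 hp).2]

end Evaluation

/-! ### Passage from irrational coupling constants to all admissible ones. -/

section Main

/-- Two functions continuous at `g > 0` which agree at positive irrationals agree at `g`. -/
theorem eq_of_continuousAt_of_irrational {f h : ℝ → ℝ} {g : ℝ} (hg : 0 < g)
    (hf : ContinuousAt f g) (hh : ContinuousAt h g)
    (heq : ∀ t, 0 < t → Irrational t → f t = h t) : f g = h g := by
  have hd : g ∈ closure {t : ℝ | Irrational t} := dense_irrational g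
  have : (𝓝[{t : ℝ | Irrational t}] g).NeBot := mem_closure_iff_nhdsWithin_neBot.1 hd
  refine tendsto_nhds_unique_of_eventuallyEq (l := 𝓝[{t : ℝ | Irrational t}] g)
    (hf.mono_left nhdsWithin_le_nhds) (hh.mono_left nhdsWithin_le_nhds) ?_
  filter_upwards [self_mem_nhdsWithin, nhdsWithin_le_nhds (lt_mem_nhds hg)] with t ht ht0
  exact heq t ht0 ht

theorem two_mul_add_ne_zero_of_irrational {g : ℝ} (hg : Irrational g) (z : ℤ) :
    2 * g + z ≠ 0 := by
  have h : Irrational (2 * g + z) := by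
    have := (hg.natCast_mul (show (2 : ℕ) ≠ 0 by norm_num)).add_intCast z
    exact_mod_cast this
  exact h.ne_zero

theorem eventually_ne_natCast (g : ℝ) (k : ℕ) : ∀ᶠ t : ℝ in 𝓝[≠] g, t ≠ k ∧ 2 * t ≠ k := by
  have h : ∀ r : ℝ, ∀ᶠ t : ℝ in 𝓝[≠] g, t ≠ r := fun r => by
    rcases eq_or_ne g r with rfl | hne
    · exact self_mem_nhdsWithin
    · exact nhdsWithin_le_nhds (isOpen_ne.mem_nhds hne)
  filter_upwards [h k, h (k / 2)] with t h1 h2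
  exact ⟨h1, fun h3 => h2 (by linarith)⟩

theorem eventually_admissible {g : ℝ} (hg : 0 < g) (M : ℕ) :
    ∀ᶠ t : ℝ in 𝓝[≠] g, 0 < t ∧ ∀ k : ℕ, 1 ≤ k → k ≤ M → t ≠ k ∧ 2 * t ≠ k := by
  have h : ∀ᶠ t : ℝ in 𝓝[≠] g, ∀ k ∈ Finset.range (M + 1), t ≠ k ∧ 2 * t ≠ k :=
    (Finset.eventually_all _).2 fun k _ => eventually_ne_natCast g k
  filter_upwards [h, nhdsWithin_le_nhds (lt_mem_nhds hg)] with t ht ht0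
  exact ⟨ht0, fun k _ hk => ht k (Finset.mem_range.2 (by omega))⟩

variable {l : Fin 3 → ℕ} {g : ℝ}

/-- At positive irrational values both arrays solve the recurrence, vanish above total degree
$\lambda_{13}$ and agree at the top position, so they coincide. Continuity of both sides at `g` does
the rest. -/
theorem firstCoeff_eq_coeff_uvPoly (hN : l13 l = l12 l + l23 l) (hg : 0 < g)
    (h : ∀ k : ℕ, 1 ≤ k → k ≤ l13 l → g ≠ k) {m n : ℕ} (hmn : m + n ≤ l13 l) :
    firstCoeff l g m n = ((uvPoly (l12 l) (l23 l) g).coeff n).coeff m := by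
  refine eq_of_continuousAt_of_irrational (f := fun t => firstCoeff l t m n) hg
    (continuousAt_firstCoeff l hN hg h hmn) (continuousAt_coeff_uvPoly _ _ hg m n)
    fun t ht hirr => ?_
  have h2 := two_mul_add_ne_zero_of_irrational hirr
  have hrec := recurrence_uvPoly (l12 l) (l23 l) ht
  rw [← hN] at hrec
  refine Recurrence.eq_of_irrational hirr (recurrence_firstCoeff l h2) hrec
    (fun m n hlt => firstCoeff_eq_zero hlt)
    (fun m n hlt => coeff_uvPoly_eq_zero _ _ _ (hN ▸ hlt)) ?_ m n
  rw [firstCoeff_zero_l13 hN h2, hN, coeff_uvPoly_top]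

theorem secondCoeff_eq_coeff_uvPoly (hN : l13 l = l12 l + l23 l) (hg : 0 < g)
    (h : ∀ k : ℕ, 1 ≤ k → k ≤ l12 l → g ≠ k ∧ 2 * g ≠ k) {m n : ℕ} (hmn : m + n ≤ l13 l) :
    secondCoeff l g m n = ((uvPoly (l12 l) (l23 l) g).coeff n).coeff m := by
  refine eq_of_continuousAt_of_irrational (f := fun t => secondCoeff l t m n) hg
    (continuousAt_secondCoeff l hN hg h hmn) (continuousAt_coeff_uvPoly _ _ hg m n)
    fun t ht hirr => ?_
  have h2 := two_mul_add_ne_zero_of_irrational hirr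
  have hrec := recurrence_uvPoly (l12 l) (l23 l) ht
  rw [← hN] at hrec
  refine Recurrence.eq_of_irrational hirr (recurrence_secondCoeff hN h2) hrec
    (fun m n hlt => secondCoeff_eq_zero hlt)
    (fun m n hlt => coeff_uvPoly_eq_zero _ _ _ (hN ▸ hlt)) ?_ m n
  rw [secondCoeff_zero_l13 hN h2, hN, coeff_uvPoly_top]

end Main

end Jack

theorem mainTheorem1 (l : Fin 3 → ℕ) (hl : Antitone l) (g : ℝ) (hg : 0 < g) :
    (∃! P : MvPolynomial (Fin 3) ℝ, Jack.IsJack g l P) ∧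
    ∀ P : MvPolynomial (Fin 3) ℝ, Jack.IsJack g l P →
      -- the first formula, whenever no denominator in it vanishes
      ((∀ k : ℕ, 1 ≤ k → k ≤ Jack.l13 l → g ≠ k) →
        ∀ x : Fin 3 → ℂ, x 2 ≠ 0 →
          MvPolynomial.aeval x P = Jack.expansion l (Jack.firstCoeff l g) x) ∧
      -- the second formula, whenever no denominator in it vanishes
      ((∀ k : ℕ, 1 ≤ k → k ≤ Jack.l12 l → g ≠ k ∧ 2 * g ≠ k) →
        ∀ x : Fin 3 → ℂ, x 2 ≠ 0 →
          MvPolynomial.aeval x P = Jack.expansion l (Jack.secondCoeff l g) x) ∧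
      -- at every `g > 0` both formulas hold with the coefficients extended by continuity
      (∃ c : ℕ → ℕ → ℝ,
        (∀ m n : ℕ, m + n ≤ Jack.l13 l →
          Tendsto (fun t : ℝ => Jack.firstCoeff l t m n) (𝓝[≠] g) (𝓝 (c m n)) ∧
          Tendsto (fun t : ℝ => Jack.secondCoeff l t m n) (𝓝[≠] g) (𝓝 (c m n))) ∧
        ∀ x : Fin 3 → ℂ, x 2 ≠ 0 →
          MvPolynomial.aeval x P = Jack.expansion l c x) := by
  have hJ := Jack.isJack_jackPoly hl hg
  have h1 : l 1 ≤ l 0 := hl (by decide)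
  have h2 : l 2 ≤ l 1 := hl (by decide)
  have hN : Jack.l13 l = Jack.l12 l + Jack.l23 l := by
    simp only [Jack.l13, Jack.l12, Jack.l23]; omega
  refine ⟨⟨_, hJ, fun Q hQ => hQ.unique hl hg hJ⟩, fun P hP => ?_⟩
  rw [hP.unique hl hg hJ]
  refine ⟨fun h x hx => ?_, fun h x hx => ?_,
    fun m n => ((Jack.uvPoly (Jack.l12 l) (Jack.l23 l) g).coeff n).coeff m, fun m n hmn => ?_,
    fun x hx => Jack.aeval_jackPoly_eq_expansion hl g hx⟩
  · rw [Jack.aeval_jackPoly_eq_expansion hl g hx]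
    exact Jack.expansion_congr
      (fun m n hmn => (Jack.firstCoeff_eq_coeff_uvPoly hN hg h hmn).symm) x
  · rw [Jack.aeval_jackPoly_eq_expansion hl g hx]
    exact Jack.expansion_congr
      (fun m n hmn => (Jack.secondCoeff_eq_coeff_uvPoly hN hg h hmn).symm) x
  -- The excluded values are finite in number, so in a punctured neighbourhood of `g` both formulas
  -- equal the coefficient of `uvPoly`, whose continuity at `g` identifies both limits.
  · have hc := (Jack.continuousAt_coeff_uvPoly (Jack.l12 l) (Jack.l23 l) hg m n).mono_left
      (nhdsWithin_le_nhds (s := {g}ᶜ))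
    have hadm := Jack.eventually_admissible hg (Jack.l13 l)
    refine ⟨hc.congr' ?_, hc.congr' ?_⟩
    · filter_upwards [hadm] with t ht
      exact (Jack.firstCoeff_eq_coeff_uvPoly hN ht.1 (fun k hk hk' => (ht.2 k hk hk').1) hmn).symm
    · filter_upwards [hadm] with t ht
      exact (Jack.secondCoeff_eq_coeff_uvPoly hN ht.1
        (fun k hk hk' => ht.2 k hk (by omega)) hmn).symm
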